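/- Let $M$ be a smooth (second countable, boundaryless, connected) manifold of finite dimension with a smooth Riemannian metric, complete for its Riemannian distance $d$. Let $T:M\to M$ be a map that is Lipschitz with respect to $d$, and let $\mu$ be an ergodic $T$-invariant Borel probability measure on $M$. For a finite measurable partition $\mathcal P$ of $M$, let $\mathcal P^n$ be the partition consisting of the intersections $\bigcap_{i=0}^{n-1}T^{-i}P_i$ with $P_i\in\mathcal P$, let $H_\mu(\mathcal P^n)=-\sum_{Q\in\mathcal P^n}\mu(Q)\log\mu(Q)$ (with $0\log 0=0$), and let $h_\mu(T,\mathcal P)=\lim_{n\to\infty}\frac1n H_\mu(\mathcal P^n)$. The measure-theoretic entropy of $T$ is $$h_\mu(T)=\sup_{\mathcal P\text{ finite}}h_\mu(T,\mathcal P)\in[0,\infty].$$ For $n\ge1$ and $r>0$ let $B_n(x,r)=\{y\in M: d(T^ix,T^iy)<r\text{ for all }0\le i\le n-1\}$. For $0<\delta<1$ let $N_\mu(n,r,\delta)$ be the minimal cardinality of a covering, by sets $B_n(x,r)$ with $x\in M$, of some measurable set of $\mu$-measure greater than $1-\delta$. Katok's lower $\delta$-entropy is $$\underline h^\delta_\mu(T)=\lim_{r\to0^+}\liminf_{n\to\infty}\frac1n\log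 N_\mu(n,r,\delta)\in[0,\infty].$$ Then, for every $0<\delta<1$, $$h_\mu(T)=\underline h^\delta_\mu(T).$$ -/

import Mathlib

open Filter Topology MeasureTheory
open scoped Bundle Manifold ContDiff ENNReal

namespace KatokEntropy

/-! ### Measure-theoretic entropy -/

/-- A finite measurable partition of `X`, with cells indexed by `Fin k`. Cells may be empty;
an empty cell contributes `0` to every entropy below. -/
structure FinPartition (X : Type*) [MeasurableSpace X] (k : ℕ) where
  cell : Fin k → Set X
  measurableSet_cell : ∀ j, MeasurableSet (cell j)
  disjoint_cell : ∀ i j, i ≠ j → Disjoint (cell i) (cell j)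
  iUnion_cell : ⋃ j, cell j = Set.univ

/-- The cell `⋂_{i < n} T⁻ⁱ P_{w i}` of the refined partition `Pⁿ = ⋁_{i < n} T⁻ⁱ P`.
Cells with distinct words `w` are disjoint. -/
def FinPartition.iterCell {X : Type*} [MeasurableSpace X] {k : ℕ} (P : FinPartition X k)
    (T : X → X) (n : ℕ) (w : Fin n → Fin k) : Set X :=
  ⋂ i : Fin n, T^[(i : ℕ)] ⁻¹' P.cell (w i)

/-- `H_μ(Pⁿ) = - ∑ μ(Q) log μ(Q)`, the sum being over the cells `Q` of `Pⁿ`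
(with `0 log 0 = 0`). -/
noncomputable def iterEntropy {X : Type*} [MeasurableSpace X] (μ : Measure X) (T : X → X)
    {k : ℕ} (P : FinPartition X k) (n : ℕ) : ℝ :=
  ∑ w : Fin n → Fin k, Real.negMulLog (μ.real (P.iterCell T n w))

/-- `h_μ(T, P) = lim_n H_μ(Pⁿ) / n`. For a `T`-invariant probability measure `n ↦ H_μ(Pⁿ)` is
subadditive, so that the limit exists and agrees with the upper limit taken here. -/
noncomputable def entropyOfPartition {X : Type*} [MeasurableSpace X] (μ : Measure X) (T : X → X)
    {k : ℕ} (P : FinPartition X k) : EReal :=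
  limsup (fun n : ℕ => ((iterEntropy μ T P n / (n : ℝ) : ℝ) : EReal)) atTop

/-- The measure-theoretic entropy `h_μ(T)`: the supremum of `h_μ(T, P)` over all finite measurable
partitions `P`. -/
noncomputable def entropy {X : Type*} [MeasurableSpace X] (μ : Measure X) (T : X → X) : EReal :=
  ⨆ (k : ℕ) (P : FinPartition X k), entropyOfPartition μ T P

/-! ### Katok's `δ`-entropy -/

/-- The dynamical ball `B_n(x, r)`: the points `y` with `d(Tⁱ x, Tⁱ y) < r` for all
`0 ≤ i ≤ n - 1`. -/
def dynBall {X : Type*} [MetricSpace X] (T : X → X) (n : ℕ) (x : X) (r : ℝ) : Set X :=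
  {y | ∀ i < n, dist (T^[i] x) (T^[i] y) < r}

/-- `N_μ(n, r, δ)`: the minimal cardinality of a covering, by `(n, r)`-dynamical balls, of a set
of `μ`-measure greater than `1 - δ` (it would be `⊤` if there were no finite such covering). -/
noncomputable def coverNumber {X : Type*} [MetricSpace X] [MeasurableSpace X] (μ : Measure X)
    (T : X → X) (n : ℕ) (r δ : ℝ) : ℕ∞ :=
  ⨅ (A : Set X) (_ : MeasurableSet A ∧ 1 - δ < μ.real A)
    (C : Finset X) (_ : A ⊆ ⋃ x ∈ C, dynBall T n x r), (C.card : ℕ∞)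

/-- `liminf_n (1 / n) log N_μ(n, r, δ)`. -/
noncomputable def lowerDeltaEntropyAt {X : Type*} [MetricSpace X] [MeasurableSpace X]
    (μ : Measure X) (T : X → X) (δ r : ℝ) : EReal :=
  liminf (fun n : ℕ => ENNReal.log (coverNumber μ T n r δ : ℝ≥0∞) / (n : EReal)) atTop

/-- Katok's lower `δ`-entropy `lim_{r → 0} liminf_n (1 / n) log N_μ(n, r, δ)`. The quantity under
the limit increases as `r` decreases, so the limit is a supremum; see
`tendsto_lowerDeltaEntropyAt`. -/
noncomputable def lowerDeltaEntropy {X : Type*} [MetricSpace X] [MeasurableSpace X]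
    (μ : Measure X) (T : X → X) (δ : ℝ) : EReal :=
  ⨆ (r : ℝ) (_ : 0 < r), lowerDeltaEntropyAt μ T δ r

theorem lowerDeltaEntropyAt_antitone {X : Type*} [MetricSpace X] [MeasurableSpace X]
    (μ : Measure X) (T : X → X) (δ : ℝ) : Antitone (lowerDeltaEntropyAt μ T δ) := by
  intro r s hrs
  refine liminf_le_liminf (Eventually.of_forall fun n => ?_)
  refine EReal.div_le_div_right_of_nonneg (by positivity) (ENNReal.log_monotone ?_)
  refine ENat.toENNReal_mono ?_
  refine iInf_mono fun A => iInf_mono fun _ => iInf_mono fun C => ?_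
  refine le_iInf fun hC => iInf_le_of_le (hC.trans ?_) le_rfl
  exact Set.iUnion₂_mono fun x _ y hy i hi => (hy i hi).trans_le hrs

/-- `lowerDeltaEntropy` is the limit as `r → 0`, `r > 0`. -/
theorem tendsto_lowerDeltaEntropyAt {X : Type*} [MetricSpace X] [MeasurableSpace X]
    (μ : Measure X) (T : X → X) (δ : ℝ) :
    Tendsto (lowerDeltaEntropyAt μ T δ) (𝓝[>] 0) (𝓝 (lowerDeltaEntropy μ T δ)) := by
  have hanti := lowerDeltaEntropyAt_antitone μ T δ
  refine tendsto_order.2 ⟨fun a ha => ?_, fun a ha => ?_⟩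
  · obtain ⟨r, hr⟩ := lt_iSup_iff.1 ha
    obtain ⟨hr0, hr⟩ := lt_iSup_iff.1 hr
    filter_upwards [Ioc_mem_nhdsGT hr0] with s hs
    exact hr.trans_le (hanti hs.2)
  · filter_upwards [self_mem_nhdsWithin] with s hs
    exact (le_iSup₂ (f := fun (r : ℝ) (_ : 0 < r) => lowerDeltaEntropyAt μ T δ r) s hs).trans_lt ha

end KatokEntropy

/-! Both inequalities come from counting itineraries. If `h` is the entropy rate of a finite
partition, then for large `n` about `exp (n h)` words of length `n` carry most of the measure
(`exists_words_card_le_exp_entropyRate`), and no set of measure bounded below is carried by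
exponentially fewer (`exp_entropyRate_le_card`). This weak form of the Shannon–McMillan theorem
needs only convergence in measure of Birkhoff averages, hence only the mean ergodic theorem.

For the entropy of a partition to be at most the `δ`-entropy, take a compact set `K` of measure
close to one on which the label is locally constant at a uniform scale. Two typical points of one
small dynamical ball can have different labels only when one of their orbits is outside `K`, which
is rare. The itineraries met in a ball thus lie in a small Hamming ball, which has few words
(`card_hammingBall_le`), so few balls would carry too few words.

For the converse, `M` need not be compact, and orbits may separate while they are away from a
compact set `K`. Absences of length `q` are rare for `q` large, by ergodicity. A partition of `K` so
fine that points with equal labels stay `r`-close for `2q` steps controls the short absences. Before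
an absence of length `s > 2q`, the position in `K` is recorded to precision `r / L ^ s`, which takes
at most `exp (s Γ)` values because `K` has finite box dimension. The long absences occupy at most a
proportion `2a` of the time, so the codes multiply the number of itineraries by at most `exp (2 a Γ
n)` (`exists_cover_card_le`). As `Γ` does not depend on the partition, `a` can be chosen first and
this factor made negligible. -/

namespace KatokEntropy

/-! ### The mean ergodic theorem and convergence in measure. -/

section MeanErgodic

variable {X : Type*} [MeasurableSpace X] {μ : Measure X}
    [IsProbabilityMeasure μ] {T : X → X}

/-- The averages converge to the orthogonal projection on the fixed vectors. By ergodicity this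
projection is a.e. constant, and its inner product with the fixed vector `1` identifies the constant
as the integral. -/
theorem tendsto_birkhoffAverage_toLp (hT : Ergodic T μ) {f : X → ℝ}
    (hf : MemLp f 2 μ) :
    Tendsto (birkhoffAverage ℝ (Lp.compMeasurePreserving T hT.toMeasurePreserving) id ·
      (hf.toLp f)) atTop
      (𝓝 (indicatorConstLp 2 MeasurableSet.univ (measure_ne_top μ _) (∫ x, f x ∂μ))) := by
  let U : Lp ℝ 2 μ →L[ℝ] Lp ℝ 2 μ :=
    (Lp.compMeasurePreservingₗᵢ ℝ T hT.toMeasurePreserving).toContinuousLinearMap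
  have hU : ‖U‖ ≤ 1 := LinearIsometry.norm_toContinuousLinearMap_le _
  have h := U.tendsto_birkhoffAverage_orthogonalProjection hU (hf.toLp f)
  set K := U.eqLocus (1 : Lp ℝ 2 μ →L[ℝ] Lp ℝ 2 μ)
  let e : Lp ℝ 2 μ := indicatorConstLp 2 MeasurableSet.univ (measure_ne_top μ _) (1 : ℝ)
  have he : e ∈ K := by
    change U e = e
    exact Lp.indicatorConstLp_compMeasurePreserving MeasurableSet.univ (measure_ne_top μ _) (1 : ℝ)
      hT.toMeasurePreserving
  set g := K.orthogonalProjectionOnto (hf.toLp f)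
  have hinner := K.inner_orthogonalProjectionOnto_eq_of_mem_left ⟨e, he⟩ (hf.toLp f)
  have h1 : inner ℝ e (g : Lp ℝ 2 μ) = inner ℝ e (hf.toLp f) := hinner
  rw [L2.inner_indicatorConstLp_one, L2.inner_indicatorConstLp_one, setIntegral_univ,
    setIntegral_univ, integral_congr_ae hf.coeFn_toLp] at h1
  have hfix : U (g : Lp ℝ 2 μ) = g := g.2
  have hae : (g : Lp ℝ 2 μ) ∘ T =ᵐ[μ] (g : Lp ℝ 2 μ) := by
    have := Lp.coeFn_compMeasurePreserving (g : Lp ℝ 2 μ) hT.toMeasurePreserving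
    refine this.symm.trans ?_
    change (U (g : Lp ℝ 2 μ) : X → ℝ) =ᵐ[μ] _
    rw [hfix]
  obtain ⟨c, hc⟩ := hT.ae_eq_const_of_ae_eq_comp_ae (Lp.aestronglyMeasurable _) hae
  have hcI : c = ∫ x, f x ∂μ := by
    rw [← h1, integral_congr_ae hc]; simp
  have hg : (g : Lp ℝ 2 μ) =
      indicatorConstLp 2 MeasurableSet.univ (measure_ne_top μ _) (∫ x, f x ∂μ) := by
    refine Lp.ext (hc.trans ?_)
    refine EventuallyEq.trans ?_ indicatorConstLp_coeFn.symm
    rw [hcI]; simp only [Set.indicator_univ]; rfl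
  rw [← hg]
  exact h

/-- Convergence in measure of the Birkhoff averages of a square integrable function. -/
theorem tendstoInMeasure_birkhoffAverage (hT : Ergodic T μ) {f : X → ℝ} (hf : MemLp f 2 μ) :
    TendstoInMeasure μ (fun n x => birkhoffAverage ℝ T f n x) atTop (fun _ => ∫ x, f x ∂μ) := by
  refine (tendstoInMeasure_of_tendsto_Lp (tendsto_birkhoffAverage_toLp hT hf)).congr
    (fun n => ?_) (indicatorConstLp_coeFn.trans (by simp only [Set.indicator_univ]; rfl))
  have hi : ∀ i : ℕ, ((Lp.compMeasurePreserving T hT.toMeasurePreserving)^[i] (hf.toLp f) : X → ℝ)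
      =ᵐ[μ] fun x => f (T^[i] x) := by
    intro i
    rw [Lp.compMeasurePreserving_iterate, Lp.toLp_compMeasurePreserving]
    exact MemLp.coeFn_toLp _
  have hsum : ((birkhoffSum (Lp.compMeasurePreserving T hT.toMeasurePreserving) id n (hf.toLp f) :
      Lp ℝ 2 μ) : X → ℝ) =ᵐ[μ] fun x => birkhoffSum T f n x := by
    induction n with
    | zero =>
      simp only [birkhoffSum_zero]
      exact Lp.coeFn_zero ℝ 2 μ
    | succ n ih =>
      rw [birkhoffSum_succ]
      filter_upwards [Lp.coeFn_add (birkhoffSum (Lp.compMeasurePreserving T hT.toMeasurePreserving)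
        id n (hf.toLp f)) ((Lp.compMeasurePreserving T hT.toMeasurePreserving)^[n] (hf.toLp f)),
        ih, hi n] with x h1 h2 h3
      rw [birkhoffSum_succ, ← h2, ← h3]
      exact h1
  unfold birkhoffAverage
  filter_upwards [hsum, Lp.coeFn_smul ((n : ℝ)⁻¹)
    (birkhoffSum (Lp.compMeasurePreserving T hT.toMeasurePreserving) id n (hf.toLp f))]
    with x h1 h2
  rw [h2, Pi.smul_apply, h1]

theorem tendsto_measureReal_birkhoffSum_gt (hT : Ergodic T μ) {f : X → ℝ} (hf : MemLp f 2 μ)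
    {ε : ℝ} (hε : 0 < ε) :
    Tendsto (fun n : ℕ => μ.real {x | n * (∫ x, f x ∂μ + ε) < birkhoffSum T f n x}) atTop
      (𝓝 0) := by
  have h := tendstoInMeasure_birkhoffAverage hT hf (ENNReal.ofReal ε) (by simpa using hε)
  have h' := (ENNReal.tendsto_toReal ENNReal.zero_ne_top).comp h
  refine squeeze_zero' (Eventually.of_forall fun n => measureReal_nonneg) ?_ h'
  filter_upwards [eventually_gt_atTop 0] with n hn
  refine measureReal_mono (fun x hx => ?_)
  simp only [Set.mem_ofPred_eq] at hx ⊢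
  have hn' : (0 : ℝ) < n := by exact_mod_cast hn
  rw [edist_dist, Real.dist_eq]
  refine ENNReal.ofReal_le_ofReal (le_trans ?_ (le_abs_self _))
  rw [birkhoffAverage, smul_eq_mul, inv_mul_eq_div, le_sub_iff_add_le, le_div_iff₀ hn']
  linarith

end MeanErgodic

/-! ### Itineraries and products of weights over windows. -/

section Words

variable {X A : Type*} {T : X → X} {lab : X → A}

/-- The first `n` labels seen along the orbit of a point. -/
def itinerary (T : X → X) (lab : X → A) (n : ℕ) (x : X) : Fin n → A := fun i => lab (T^[i] x)

theorem init_itinerary (n : ℕ) (x : X) :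
    Fin.init (itinerary T lab (n + 1) x) = itinerary T lab n x := rfl

/-- The factor of length `k + 1` of a word which starts at the position `i`. -/
def window {k N : ℕ} (w : Fin (k + N) → A) (i : Fin N) : Fin (k + 1) → A :=
  fun j => w ⟨i + j, by omega⟩

theorem window_itinerary (k N : ℕ) (x : X) (i : Fin N) :
    window (itinerary T lab (k + N) x) i = itinerary T lab (k + 1) (T^[i] x) := by
  funext j
  simp only [window, itinerary]
  rw [add_comm (i : ℕ) j, Function.iterate_add_apply]

/-- The product of a weight over all the factors of length `k + 1` of a word. -/
noncomputable def windowProd {k : ℕ} (c : (Fin (k + 1) → A) → ℝ) {N : ℕ} (w : Fin (k + N) → A) :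
    ℝ :=
  ∏ i, c (window w i)

/-- The last letter occurs only in the last window, so summing over it costs a factor at most `1`.
After `N` such steps only the `|A| ^ k` initial words remain. -/
theorem sum_windowProd_le [Fintype A] {k : ℕ} {c : (Fin (k + 1) → A) → ℝ} (hc : ∀ v, 0 ≤ c v)
    (hsum : ∀ u : Fin k → A, ∑ a, c (Fin.snoc u a) ≤ 1) (N : ℕ) :
    ∑ w : Fin (k + N) → A, windowProd c w ≤ (Fintype.card A : ℝ) ^ k := by
  classical
  induction N with
  | zero => simp [windowProd]
  | succ N ih =>
    refine le_trans ?_ ih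
    change ∑ w : Fin (k + N + 1) → A, _ ≤ _
    rw [← (Fin.snocEquiv (fun _ : Fin (k + N + 1) => A)).sum_comp, Fintype.sum_prod_type_right]
    refine Finset.sum_le_sum fun u _ => ?_
    have key : ∀ a, windowProd c (N := N + 1) (Fin.snocEquiv (fun _ : Fin (k + N + 1) => A) (a, u))
        = windowProd c u * c (Fin.snoc (fun j : Fin k => u ⟨N + j, by omega⟩) a) := by
      intro a
      unfold windowProd
      rw [Fin.prod_univ_castSucc]
      congr 1
      · refine Finset.prod_congr rfl fun i _ => ?_
        congr 1
        funext j
        simp only [window, Fin.snocEquiv_apply]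
        rw [show (⟨(i.castSucc : ℕ) + j, by omega⟩ : Fin (k + N + 1)) =
          Fin.castSucc ⟨i + j, by omega⟩ from rfl, Fin.snoc_castSucc]
      · congr 1
        funext j
        simp only [window, Fin.snocEquiv_apply]
        induction j using Fin.lastCases with
        | last =>
          rw [Fin.snoc_last, show (⟨((Fin.last N : Fin (N + 1)) : ℕ) + (Fin.last k : Fin (k + 1)),
            by simp; omega⟩ : Fin (k + N + 1)) = Fin.last (k + N) by
              ext; simp; omega, Fin.snoc_last]
        | cast j =>
          rw [Fin.snoc_castSucc, show (⟨((Fin.last N : Fin (N + 1)) : ℕ) + (j.castSucc : Fin (k + 1)),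
            by simp; omega⟩ : Fin (k + N + 1)) = Fin.castSucc ⟨N + j, by omega⟩ by
              ext; simp, Fin.snoc_castSucc]
    simp_rw [key, ← Finset.mul_sum]
    exact mul_le_of_le_one_right (Finset.prod_nonneg fun _ _ => hc _) (hsum _)

end Words

/-! ### Word probabilities, conditional probabilities and the chain rule. -/

section WordEntropy

variable {X A : Type*} [MeasurableSpace X] {μ : Measure X} {T : X → X} {lab : X → A}

/-- The probability of a word. -/
noncomputable def wordProb (μ : Measure X) (T : X → X) (lab : X → A) (n : ℕ) (w : Fin n → A) : ℝ :=
  μ.real {x | itinerary T lab n x = w}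

/-- The entropy of the distribution of the words of length `n`. -/
noncomputable def wordEntropy [Fintype A] (μ : Measure X) (T : X → X) (lab : X → A) (n : ℕ) : ℝ :=
  ∑ w : Fin n → A, Real.negMulLog (wordProb μ T lab n w)

theorem wordProb_nonneg (n : ℕ) (w : Fin n → A) : 0 ≤ wordProb μ T lab n w := measureReal_nonneg

theorem wordProb_succ_le [IsFiniteMeasure μ] (n : ℕ) (v : Fin (n + 1) → A) :
    wordProb μ T lab (n + 1) v ≤ wordProb μ T lab n (Fin.init v) :=
  measureReal_mono fun x (hx : _ = _) => by
    change _ = _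
    rw [← hx, init_itinerary]

theorem sum_snoc [Fintype A] {n : ℕ} (g : (Fin (n + 1) → A) → ℝ) :
    ∑ v, g v = ∑ u : Fin n → A, ∑ a, g (Fin.snoc u a) := by
  rw [← (Fin.snocEquiv (fun _ : Fin (n + 1) => A)).sum_comp, Fintype.sum_prod_type_right]
  rfl

/-- The probability of the last letter of a word given the other ones. -/
noncomputable def condProb (μ : Measure X) (T : X → X) (lab : X → A) (k : ℕ)
    (v : Fin (k + 1) → A) : ℝ :=
  wordProb μ T lab (k + 1) v / wordProb μ T lab k (Fin.init v)

theorem condProb_nonneg (k : ℕ) (v : Fin (k + 1) → A) : 0 ≤ condProb μ T lab k v :=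
  div_nonneg measureReal_nonneg measureReal_nonneg

theorem condProb_le_one [IsFiniteMeasure μ] (k : ℕ) (v : Fin (k + 1) → A) :
    condProb μ T lab k v ≤ 1 :=
  div_le_one_of_le₀ (wordProb_succ_le k v) measureReal_nonneg

/-- Only finitely many words exist, so those of probability zero are a.e. avoided. Positivity is
what later turns the logarithm of a product into a sum, since `Real.log 0 = 0` would falsify it. -/
theorem ae_condProb_pos [Finite A] [IsFiniteMeasure μ] (k : ℕ) :
    ∀ᵐ x ∂μ, 0 < condProb μ T lab k (itinerary T lab (k + 1) x) := by
  have h : ∀ v, ∀ᵐ x ∂μ, itinerary T lab (k + 1) x = v → wordProb μ T lab (k + 1) v ≠ 0 := by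
    intro v
    by_cases hv : wordProb μ T lab (k + 1) v = 0
    · have : ∀ᵐ x ∂μ, itinerary T lab (k + 1) x ≠ v := by
        rw [ae_iff]
        simpa [wordProb, measureReal_eq_zero_iff] using hv
      filter_upwards [this] with x hx hx' using absurd hx' hx
    · exact Eventually.of_forall fun _ _ => hv
  filter_upwards [ae_all_iff.2 h] with x hx
  have h1 := (wordProb_nonneg (μ := μ) (T := T) (lab := lab) (k + 1)
    (itinerary T lab (k + 1) x)).lt_of_ne' (hx _ rfl)
  exact div_pos h1 (h1.trans_le (wordProb_succ_le k _))

variable [MeasurableSpace A]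

theorem measurable_itinerary (hT : Measurable T) (hlab : Measurable lab) (n : ℕ) :
    Measurable (itinerary T lab n) :=
  measurable_pi_lambda _ fun i => hlab.comp (hT.iterate i)

variable [MeasurableSingletonClass A]

theorem measurableSet_itinerary_mem [Finite A] (hT : Measurable T) (hlab : Measurable lab) (n : ℕ)
    (W : Set (Fin n → A)) : MeasurableSet {x | itinerary T lab n x ∈ W} :=
  measurable_itinerary hT hlab n W.toFinite.measurableSet

variable [IsProbabilityMeasure μ]

theorem sum_wordProb (hT : Measurable T) (hlab : Measurable lab) (n : ℕ)
    (W : Finset (Fin n → A)) :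
    ∑ w ∈ W, wordProb μ T lab n w = μ.real {x | itinerary T lab n x ∈ W} :=
  sum_measureReal_preimage_singleton W fun w _ =>
    measurable_itinerary hT hlab n (measurableSet_singleton w)

variable [Fintype A]

theorem sum_wordProb_univ (hT : Measurable T) (hlab : Measurable lab) (n : ℕ) :
    ∑ w, wordProb μ T lab n w = 1 := by
  rw [sum_wordProb hT hlab]; simp

theorem sum_wordProb_snoc (hT : Measurable T) (hlab : Measurable lab) (n : ℕ) (u : Fin n → A) :
    ∑ a, wordProb μ T lab (n + 1) (Fin.snoc u a) = wordProb μ T lab n u := by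
  classical
  have hinj : Function.Injective fun a : A => (Fin.snoc u a : Fin (n + 1) → A) := fun a b h => by
    simpa using congrFun h (Fin.last n)
  have := sum_wordProb (μ := μ) hT hlab (n + 1) (Finset.univ.map ⟨_, hinj⟩)
  rw [Finset.sum_map] at this
  refine this.trans ?_
  unfold wordProb
  congr 1
  ext x
  simp only [Finset.mem_map, Finset.mem_univ, true_and, Set.mem_ofPred_eq,
    Function.Embedding.coeFn_mk, ← init_itinerary n x]
  constructor
  · rintro ⟨a, ha⟩
    rw [← ha, Fin.init_snoc]
  · intro h
    exact ⟨itinerary T lab (n + 1) x (Fin.last n), by rw [← h, Fin.snoc_init_self]⟩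

theorem sum_condProb_snoc_le (hT : Measurable T) (hlab : Measurable lab) (k : ℕ) (u : Fin k → A) :
    ∑ a, condProb μ T lab k (Fin.snoc u a) ≤ 1 := by
  simp only [condProb, Fin.init_snoc]
  rw [← Finset.sum_div, sum_wordProb_snoc hT hlab]
  exact div_self_le_one _

/-- The chain rule for entropy: it gives the mean of the observable whose Birkhoff sums are minus
the logarithms of the `k`-step Markov weights. -/
theorem sum_wordProb_mul_neg_log_condProb (hT : Measurable T) (hlab : Measurable lab) (k : ℕ) :
    ∑ v, wordProb μ T lab (k + 1) v * -Real.log (condProb μ T lab k v) =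
      wordEntropy μ T lab (k + 1) - wordEntropy μ T lab k := by
  have h1 : ∀ v : Fin (k + 1) → A,
      wordProb μ T lab (k + 1) v * -Real.log (condProb μ T lab k v) =
      Real.negMulLog (wordProb μ T lab (k + 1) v) +
        wordProb μ T lab (k + 1) v * Real.log (wordProb μ T lab k (Fin.init v)) := by
    intro v
    rcases (wordProb_nonneg (μ := μ) (T := T) (lab := lab) (k + 1) v).eq_or_lt with h | h
    · simp [← h]
    · have h' := h.trans_le (wordProb_succ_le k v)
      rw [condProb, Real.log_div h.ne' h'.ne', Real.negMulLog]
      ring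
  have h2 : ∑ v : Fin (k + 1) → A,
      wordProb μ T lab (k + 1) v * Real.log (wordProb μ T lab k (Fin.init v)) =
      -wordEntropy μ T lab k := by
    rw [sum_snoc, wordEntropy, ← Finset.sum_neg_distrib]
    refine Finset.sum_congr rfl fun u _ => ?_
    simp only [Fin.init_snoc]
    rw [← Finset.sum_mul, sum_wordProb_snoc hT hlab, Real.negMulLog]
    ring
  simp_rw [h1]
  rw [Finset.sum_add_distrib, h2, ← sub_eq_add_neg]
  rfl

theorem wordEntropy_le_succ (hT : Measurable T) (hlab : Measurable lab) (k : ℕ) :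
    wordEntropy μ T lab k ≤ wordEntropy μ T lab (k + 1) := by
  rw [← sub_nonneg, ← sum_wordProb_mul_neg_log_condProb hT hlab]
  exact Finset.sum_nonneg fun v _ => mul_nonneg measureReal_nonneg
    (neg_nonneg.2 (Real.log_nonpos (condProb_nonneg k v) (condProb_le_one k v)))

theorem integral_comp_itinerary (hT : Measurable T) (hlab : Measurable lab) (n : ℕ)
    (g : (Fin n → A) → ℝ) :
    ∫ x, g (itinerary T lab n x) ∂μ = ∑ w, wordProb μ T lab n w * g w := by
  have hm := measurable_itinerary hT hlab n
  have := Measure.isProbabilityMeasure_map (μ := μ) hm.aemeasurable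
  rw [← integral_map hm.aemeasurable (measurable_of_finite g).aestronglyMeasurable,
    integral_fintype (Integrable.of_finite)]
  refine Finset.sum_congr rfl fun w _ => ?_
  rw [smul_eq_mul, map_measureReal_apply hm (measurableSet_singleton w)]
  rfl

theorem memLp_comp_itinerary (hT : Measurable T) (hlab : Measurable lab) (n : ℕ)
    (g : (Fin n → A) → ℝ) : MemLp (fun x => g (itinerary T lab n x)) 2 μ := by
  obtain ⟨C, hC⟩ := (Set.finite_range fun w => ‖g w‖).bddAbove
  exact MemLp.of_bound ((measurable_of_finite g).comp
    (measurable_itinerary hT hlab n)).aestronglyMeasurable C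
    (Eventually.of_forall fun x => hC ⟨_, rfl⟩)

end WordEntropy

/-! ### Counting typical words: a weak Shannon–McMillan theorem. -/

section TypicalWords

/-- The entropy of a subprobability vector on a finite set is controlled by its mass and by the
cardinality of the set. -/
theorem sum_negMulLog_le {ι : Type*} (W : Finset ι) {p : ι → ℝ} (hp : ∀ i, 0 ≤ p i)
    (hs : ∑ i ∈ W, p i ≤ 1) :
    ∑ i ∈ W, Real.negMulLog (p i) ≤ 1 + (∑ i ∈ W, p i) * Real.log W.card := by
  rcases W.eq_empty_or_nonempty with rfl | hW
  · simp
  have hc : (0 : ℝ) < W.card := by exact_mod_cast hW.card_pos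
  have h := Real.concaveOn_negMulLog.le_map_sum (t := W) (w := fun _ => (W.card : ℝ)⁻¹) (p := p)
    (fun _ _ => by positivity) (by simp [hc.ne']) (fun i _ => hp i)
  simp only [smul_eq_mul, ← Finset.mul_sum] at h
  set s := ∑ i ∈ W, p i with hsdef
  have hs0 : 0 ≤ s := Finset.sum_nonneg fun i _ => hp i
  have h1 : Real.negMulLog s ≤ 1 := by
    rcases hs0.eq_or_lt with h0 | h0
    · simp [← h0]
    · have := Real.log_le_sub_one_of_pos (inv_pos.2 h0)
      rw [Real.log_inv] at this
      have h2 := mul_le_mul_of_nonneg_left this h0.le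
      rw [mul_sub, mul_inv_cancel₀ h0.ne'] at h2
      rw [Real.negMulLog]
      linarith
  have h2 : Real.negMulLog ((W.card : ℝ)⁻¹ * s) =
      (W.card : ℝ)⁻¹ * (Real.negMulLog s + s * Real.log W.card) := by
    rw [Real.negMulLog_mul, Real.negMulLog, Real.log_inv]
    ring
  rw [h2] at h
  linarith [le_of_mul_le_mul_left h (inv_pos.2 hc)]

theorem log_card_le {n : ℕ} {A : Type*} [Fintype A] [Nonempty A] (W : Finset (Fin n → A)) :
    Real.log W.card ≤ n * Real.log (Fintype.card A) := by
  rcases W.eq_empty_or_nonempty with rfl | hW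
  · simpa using mul_nonneg n.cast_nonneg (Real.log_natCast_nonneg _)
  rw [← Real.log_pow]
  refine Real.log_le_log (by exact_mod_cast hW.card_pos) ?_
  have := Finset.card_le_univ W
  rw [Fintype.card_fun, Fintype.card_fin] at this
  exact_mod_cast this

variable {X A : Type*} [MeasurableSpace X] {μ : Measure X} {T : X → X} {lab : X → A}
  [MeasurableSpace A] [Fintype A] [MeasurableSingletonClass A] [IsProbabilityMeasure μ]

/-- The process is compared with its `k`-step Markov approximation. Words of large Markov weight are
few, because the weights have bounded sum; they are typical, because minus the logarithm of the
weight of an itinerary is a Birkhoff sum whose mean is the entropy increment. -/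
theorem exists_typical_words (hT : Ergodic T μ) (hlab : Measurable lab) (k : ℕ) {ε : ℝ}
    (hε : 0 < ε) : ∀ᶠ n : ℕ in atTop, ∃ W : Finset (Fin n → A),
      (W.card : ℝ) ≤ Real.exp (n * (wordEntropy μ T lab (k + 1) - wordEntropy μ T lab k + ε)) ∧
      1 - ε ≤ μ.real {x | itinerary T lab n x ∈ W} := by
  classical
  have hTm := hT.toMeasurePreserving.measurable
  set h' := wordEntropy μ T lab (k + 1) - wordEntropy μ T lab k with hh'
  have hh0 : 0 ≤ h' := sub_nonneg.2 (wordEntropy_le_succ hTm hlab k)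
  set g : (Fin (k + 1) → A) → ℝ := fun v => -Real.log (condProb μ T lab k v) with hg
  have hint : ∫ x, g (itinerary T lab (k + 1) x) ∂μ = h' := by
    rw [integral_comp_itinerary hTm hlab, sum_wordProb_mul_neg_log_condProb hTm hlab]
  have hev1 := (tendsto_measureReal_birkhoffSum_gt hT (memLp_comp_itinerary hTm hlab (k + 1) g)
    (half_pos hε)).eventually (gt_mem_nhds hε)
  rw [hint] at hev1
  have hev2 : ∀ᶠ N : ℕ in atTop, (Fintype.card A : ℝ) ^ k ≤ Real.exp (N * (ε / 2)) :=
    (Real.tendsto_exp_atTop.comp (tendsto_natCast_atTop_atTop.atTop_mul_const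
      (half_pos hε))).eventually_ge_atTop _
  filter_upwards [(tendsto_sub_atTop_nat k).eventually hev1,
    (tendsto_sub_atTop_nat k).eventually hev2, eventually_ge_atTop k] with n h1 h2 hkn
  obtain ⟨N, rfl⟩ := Nat.exists_eq_add_of_le hkn
  rw [Nat.add_sub_cancel_left] at h1 h2
  -- Half of `ε` is the Birkhoff deviation; the other half absorbs the factor `|A| ^ k`.
  set W : Finset (Fin (k + N) → A) := Finset.univ.filter fun w =>
    Real.exp (-(N * (h' + ε / 2))) ≤ windowProd (condProb μ T lab k) w with hW
  refine ⟨W, ?_, ?_⟩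
  · have hsum := sum_windowProd_le (c := condProb μ T lab k) (condProb_nonneg k)
      (sum_condProb_snoc_le hTm hlab k) N
    have hcard : (W.card : ℝ) * Real.exp (-(N * (h' + ε / 2))) ≤ (Fintype.card A : ℝ) ^ k := by
      refine le_trans ?_ hsum
      rw [← nsmul_eq_mul]
      refine le_trans (Finset.card_nsmul_le_sum W _ _ fun w hw => (Finset.mem_filter.1 hw).2) ?_
      exact Finset.sum_le_sum_of_subset_of_nonneg (Finset.subset_univ _) fun w _ _ =>
        Finset.prod_nonneg fun _ _ => condProb_nonneg _ _
    rw [Real.exp_neg, ← div_eq_mul_inv, div_le_iff₀ (Real.exp_pos _)] at hcard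
    refine hcard.trans ((mul_le_mul_of_nonneg_right h2 (Real.exp_pos _).le).trans ?_)
    rw [← Real.exp_add]
    refine Real.exp_le_exp.2 ?_
    push_cast
    have : 0 ≤ (k : ℝ) * (h' + ε) := by positivity
    linarith
  · have hae : ∀ᵐ x ∂μ, ∀ i : ℕ, 0 < condProb μ T lab k (itinerary T lab (k + 1) (T^[i] x)) :=
      ae_all_iff.2 fun i => (hT.toMeasurePreserving.iterate i).quasiMeasurePreserving.ae
        (ae_condProb_pos (μ := μ) (T := T) (lab := lab) k)
    set B := {x | N * (h' + ε / 2) < birkhoffSum T (fun x => g (itinerary T lab (k + 1) x)) N x}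
      with hB
    have hcover : ∀ᵐ x ∂μ, x ∈ {x | itinerary T lab (k + N) x ∈ W} ∪ B := by
      filter_upwards [hae] with x hx
      by_cases hxB : x ∈ B
      · exact Or.inr hxB
      refine Or.inl ?_
      simp only [hB, Set.mem_ofPred_eq, not_lt] at hxB
      simp only [hW, Set.mem_ofPred_eq, Finset.mem_filter, Finset.mem_univ, true_and]
      have hprod : windowProd (condProb μ T lab k) (itinerary T lab (k + N) x) =
          ∏ i ∈ Finset.range N, condProb μ T lab k (itinerary T lab (k + 1) (T^[i] x)) := by
        unfold windowProd
        simp_rw [window_itinerary]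
        exact Fin.prod_univ_eq_prod_range
          (fun i => condProb μ T lab k (itinerary T lab (k + 1) (T^[i] x))) N
      rw [hprod, ← Real.le_log_iff_exp_le (Finset.prod_pos fun i _ => hx i),
        Real.log_prod fun i _ => (hx i).ne']
      simp only [birkhoffSum, hg, Finset.sum_neg_distrib] at hxB
      linarith
    have h3 : (1 : ℝ) = μ.real ({x | itinerary T lab (k + N) x ∈ W} ∪ B) :=
      (probReal_univ (μ := μ)).symm.trans (measureReal_congr (eventuallyEq_univ.2 hcover).symm)
    have h4 := measureReal_union_le (μ := μ) {x | itinerary T lab (k + N) x ∈ W} B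
    linarith

/-- The entropy per unit of time of the process of labels. -/
noncomputable def entropyRate (μ : Measure X) (T : X → X) (lab : X → A) : ℝ :=
  ⨅ k, (wordEntropy μ T lab (k + 1) - wordEntropy μ T lab k)

theorem bddBelow_entropyRate (hT : Measurable T) (hlab : Measurable lab) :
    BddBelow (Set.range fun k => wordEntropy μ T lab (k + 1) - wordEntropy μ T lab k) :=
  ⟨0, Set.forall_mem_range.2 fun k => sub_nonneg.2 (wordEntropy_le_succ hT hlab k)⟩

theorem entropyRate_nonneg (hT : Measurable T) (hlab : Measurable lab) :
    0 ≤ entropyRate μ T lab :=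
  le_ciInf fun k => sub_nonneg.2 (wordEntropy_le_succ hT hlab k)

theorem mul_entropyRate_le_wordEntropy (hT : Measurable T) (hlab : Measurable lab) (n : ℕ) :
    n * entropyRate μ T lab ≤ wordEntropy μ T lab n := by
  have h0 : wordEntropy μ T lab 0 = 0 := by
    simp [wordEntropy, wordProb, Subsingleton.elim _ (default : Fin 0 → A)]
  have h := Finset.sum_range_sub (wordEntropy μ T lab) n
  rw [h0, sub_zero] at h
  rw [← h]
  have := Finset.card_nsmul_le_sum (Finset.range n)
    (fun k => wordEntropy μ T lab (k + 1) - wordEntropy μ T lab k) (entropyRate μ T lab)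
    fun k _ => ciInf_le (bddBelow_entropyRate hT hlab) k
  simpa using this

/-- For large `n`, most of the space is covered by about `exp (n h)` words of length `n`. -/
theorem exists_words_card_le_exp_entropyRate (hT : Ergodic T μ) (hlab : Measurable lab) {ε : ℝ}
    (hε : 0 < ε) : ∀ᶠ n : ℕ in atTop, ∃ W : Finset (Fin n → A),
      (W.card : ℝ) ≤ Real.exp (n * (entropyRate μ T lab + ε)) ∧
      1 - ε ≤ μ.real {x | itinerary T lab n x ∈ W} := by
  obtain ⟨k, hk⟩ := exists_lt_of_ciInf_lt
    (show entropyRate μ T lab < entropyRate μ T lab + ε / 2 by linarith)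
  filter_upwards [exists_typical_words hT hlab k (half_pos hε)] with n ⟨W, hW, hW'⟩
  refine ⟨W, hW.trans (Real.exp_le_exp.2 ?_), by linarith⟩
  exact mul_le_mul_of_nonneg_left (by linarith) n.cast_nonneg

/-- Telescoping bounds the quotients below by the infimum of the increments, so monotonicity of the
increments is not needed. Above, the typical words contribute at most `1 + n (h + ε)`, and the
others, of total mass at most `ε`, at most `1 + ε n log |A|`. -/
theorem tendsto_wordEntropy_div (hT : Ergodic T μ) (hlab : Measurable lab) :
    Tendsto (fun n : ℕ => wordEntropy μ T lab n / n) atTop (𝓝 (entropyRate μ T lab)) := by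
  classical
  have hTm := hT.toMeasurePreserving.measurable
  have : Nonempty A := ⟨lab (nonempty_of_isProbabilityMeasure μ).some⟩
  have hh := entropyRate_nonneg (μ := μ) hTm hlab
  have hA : 0 ≤ Real.log (Fintype.card A) := Real.log_natCast_nonneg _
  refine tendsto_order.2 ⟨fun a ha => ?_, fun a ha => ?_⟩
  · filter_upwards [eventually_gt_atTop 0] with n hn
    refine ha.trans_le ?_
    rw [le_div_iff₀ (by exact_mod_cast hn), mul_comm]
    exact mul_entropyRate_le_wordEntropy hTm hlab n
  · set η := a - entropyRate μ T lab with hη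
    have hη0 : 0 < η := sub_pos.2 ha
    set ε := η / (3 + Real.log (Fintype.card A)) with hε
    have hε0 : 0 < ε := by positivity
    have hεη : ε * (3 + Real.log (Fintype.card A)) = η := div_mul_cancel₀ _ (by positivity)
    filter_upwards [exists_words_card_le_exp_entropyRate hT hlab hε0, eventually_gt_atTop 0,
      (tendsto_natCast_atTop_atTop.atTop_mul_const hε0).eventually_gt_atTop (2 : ℝ)]
      with n ⟨W, hW, hW'⟩ hn hn2
    have hn' : (0 : ℝ) < n := by exact_mod_cast hn
    rw [div_lt_iff₀ hn']
    have hsum := sum_wordProb (μ := μ) hTm hlab n W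
    have htot := sum_wordProb_univ (μ := μ) hTm hlab n
    rw [← Finset.sum_add_sum_compl W] at htot
    have hnn : ∀ S : Finset (Fin n → A), 0 ≤ ∑ w ∈ S, wordProb μ T lab n w :=
      fun S => Finset.sum_nonneg fun w _ => wordProb_nonneg _ _
    have h1 := sum_negMulLog_le W (wordProb_nonneg (μ := μ) (T := T) (lab := lab) n)
      (by linarith [hnn Wᶜ])
    have h2 := sum_negMulLog_le Wᶜ (wordProb_nonneg (μ := μ) (T := T) (lab := lab) n)
      (by linarith [hnn W])
    have hH : wordEntropy μ T lab n = _ :=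
      (Finset.sum_add_sum_compl W fun w => Real.negMulLog (wordProb μ T lab n w)).symm
    have hlog : Real.log W.card ≤ n * (entropyRate μ T lab + ε) := by
      rcases W.card.eq_zero_or_pos with h | h
      · rw [h]; simp; positivity
      · exact (Real.log_le_iff_le_exp (by exact_mod_cast h)).2 hW
    have h3 : (∑ w ∈ W, wordProb μ T lab n w) * Real.log W.card ≤ Real.log W.card :=
      mul_le_of_le_one_left (Real.log_natCast_nonneg _) (by linarith [hnn Wᶜ])
    have h4 : (∑ w ∈ Wᶜ, wordProb μ T lab n w) * Real.log (Wᶜ).card ≤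
        ε * (n * Real.log (Fintype.card A)) :=
      mul_le_mul (by linarith) (log_card_le _) (Real.log_natCast_nonneg _) hε0.le
    rw [hH]
    have h5 : n * (ε * (3 + Real.log (Fintype.card A))) = n * η := by rw [hεη]
    have h6 : a = entropyRate μ T lab + η := by rw [hη]; ring
    rw [h6]
    nlinarith

/-- For large `n`, a set of measure bounded below cannot be covered by much less than
`exp (n h)` words of length `n`. -/
theorem exp_entropyRate_le_card (hT : Ergodic T μ) (hlab : Measurable lab) {c ε : ℝ}
    (hc : 0 < c) (hε : 0 < ε) : ∀ᶠ n : ℕ in atTop, ∀ W : Finset (Fin n → A),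
      c ≤ μ.real {x | itinerary T lab n x ∈ W} →
      Real.exp (n * (entropyRate μ T lab - ε)) ≤ W.card := by
  classical
  have hTm := hT.toMeasurePreserving.measurable
  have : Nonempty A := ⟨lab (nonempty_of_isProbabilityMeasure μ).some⟩
  set h := entropyRate μ T lab with hdef
  have hh : 0 ≤ h := entropyRate_nonneg hTm hlab
  have hA : 0 ≤ Real.log (Fintype.card A) := Real.log_natCast_nonneg _
  -- Chosen so that the errors `n η` from `V \ W` and `n η log |A|` from the remaining words use up
  -- half of the gain `n c ε`.
  set η := c * ε / (2 * (1 + Real.log (Fintype.card A))) with hη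
  have hη0 : 0 < η := by positivity
  have hηe : η * (1 + Real.log (Fintype.card A)) = c * ε / 2 := by
    rw [hη]; field_simp
  have hcε : 0 < c * ε / 2 := by positivity
  filter_upwards [exists_words_card_le_exp_entropyRate hT hlab hη0, eventually_gt_atTop 0,
    (tendsto_natCast_atTop_atTop.atTop_mul_const hcε).eventually_gt_atTop (3 : ℝ)]
    with n ⟨V, hV, hV'⟩ hn hn2 W hW
  -- If `W` were that small, splitting the words into `W`, `V \ W` and the rest would bound the
  -- entropy by `3 + n h - n c ε / 2`, which is below its lower bound `n h`.
  by_contra! hlt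
  have hn' : (0 : ℝ) < n := by exact_mod_cast hn
  have hWV : Disjoint W (V \ W) := Finset.disjoint_sdiff
  have hnn : ∀ S : Finset (Fin n → A), 0 ≤ ∑ w ∈ S, wordProb μ T lab n w :=
    fun S => Finset.sum_nonneg fun w _ => wordProb_nonneg _ _
  have htot := sum_wordProb_univ (μ := μ) hTm hlab n
  rw [← Finset.sum_add_sum_compl (W ∪ (V \ W)), Finset.sum_union hWV] at htot
  have hH : wordEntropy μ T lab n = _ :=
    (Finset.sum_add_sum_compl (W ∪ (V \ W)) fun w => Real.negMulLog (wordProb μ T lab n w)).symm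
  rw [Finset.sum_union hWV] at hH
  have hs1 := sum_wordProb (μ := μ) hTm hlab n W
  have hVs : ∑ w ∈ V, wordProb μ T lab n w ≤ ∑ w ∈ W ∪ (V \ W), wordProb μ T lab n w := by
    refine Finset.sum_le_sum_of_subset_of_nonneg (fun w hw => ?_) fun w _ _ => wordProb_nonneg _ _
    by_cases hw' : w ∈ W <;> simp [hw, hw']
  rw [Finset.sum_union hWV, sum_wordProb hTm hlab n V] at hVs
  have hp := wordProb_nonneg (μ := μ) (T := T) (lab := lab) n
  have e1 := sum_negMulLog_le W hp (by linarith [hnn (V \ W), hnn (W ∪ (V \ W))ᶜ])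
  have e2 := sum_negMulLog_le (V \ W) hp (by linarith [hnn W, hnn (W ∪ (V \ W))ᶜ])
  have e3 := sum_negMulLog_le (W ∪ (V \ W))ᶜ hp (by linarith [hnn W, hnn (V \ W)])
  set s1 := ∑ w ∈ W, wordProb μ T lab n w
  set s2 := ∑ w ∈ V \ W, wordProb μ T lab n w
  set s3 := ∑ w ∈ (W ∪ (V \ W))ᶜ, wordProb μ T lab n w
  have hWpos : 0 < W.card := by
    rw [Finset.card_pos, Finset.nonempty_iff_ne_empty]
    rintro rfl
    simp at hW
    linarith
  have l1 : Real.log W.card ≤ n * (h - ε) :=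
    (Real.log_le_iff_le_exp (by exact_mod_cast hWpos)).2 hlt.le
  have l2 : Real.log (V \ W).card ≤ n * (h + η) := by
    rcases (V \ W).card.eq_zero_or_pos with h0 | h0
    · rw [h0]; simp; positivity
    · refine (Real.log_le_iff_le_exp (by exact_mod_cast h0)).2 (le_trans ?_ hV)
      exact_mod_cast Finset.card_le_card Finset.sdiff_subset
  have f1 : s1 * Real.log W.card ≤ s1 * (n * (h - ε)) := mul_le_mul_of_nonneg_left l1 (hnn _)
  have f2 : s2 * Real.log (V \ W).card ≤ s2 * (n * (h + η)) :=
    mul_le_mul_of_nonneg_left l2 (hnn _)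
  have f3 : s3 * Real.log (W ∪ (V \ W))ᶜ.card ≤ η * (n * Real.log (Fintype.card A)) :=
    mul_le_mul (by linarith) (log_card_le _) (Real.log_natCast_nonneg _) hη0.le
  have hlow := mul_entropyRate_le_wordEntropy (μ := μ) hTm hlab n
  have g1 : n * (c * ε) ≤ n * (s1 * ε) := by
    have : c ≤ s1 := by linarith
    gcongr
  have g2 : n * ((s1 + s2) * h) ≤ n * h := by
    have : s1 + s2 ≤ 1 := by linarith [hnn (W ∪ (V \ W))ᶜ]
    exact mul_le_mul_of_nonneg_left (mul_le_of_le_one_left hh this) hn'.le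
  have g3 : n * (s2 * η) ≤ n * η := by
    have : s2 ≤ 1 := by linarith [hnn (W ∪ (V \ W))ᶜ, hnn W]
    exact mul_le_mul_of_nonneg_left (mul_le_of_le_one_left hη0.le this) hn'.le
  have g4 : n * (η * (1 + Real.log (Fintype.card A))) = n * (c * ε / 2) := by rw [hηe]
  rw [← hdef] at hlow
  linarith

end TypicalWords

/-! ### From partitions to labels. -/

section Partition

variable {X : Type*} [MeasurableSpace X] {μ : Measure X} {T : X → X} {k : ℕ}

theorem FinPartition.exists_label (P : FinPartition X k) :
    ∃ lab : X → Fin k, Measurable lab ∧ ∀ x j, x ∈ P.cell j ↔ lab x = j := by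
  have h : ∀ x, ∃ j, x ∈ P.cell j := fun x => by
    have : x ∈ ⋃ j, P.cell j := by rw [P.iUnion_cell]; trivial
    exact Set.mem_iUnion.1 this
  choose lab hlab using h
  have hiff : ∀ x j, x ∈ P.cell j ↔ lab x = j := fun x j =>
    ⟨fun hx => by_contra fun hne =>
      Set.disjoint_left.1 (P.disjoint_cell _ _ hne) (hlab x) hx, fun hx => hx ▸ hlab x⟩
  refine ⟨lab, measurable_to_countable' fun j => ?_, hiff⟩
  have : lab ⁻¹' {j} = P.cell j := Set.ext fun x => (hiff x j).symm
  rw [this]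
  exact P.measurableSet_cell j

/-- The partition into the level sets of a measurable map. -/
def FinPartition.ofLabel (lab : X → Fin k) (hlab : Measurable lab) : FinPartition X k where
  cell j := lab ⁻¹' {j}
  measurableSet_cell j := hlab (measurableSet_singleton j)
  disjoint_cell i j hij := Disjoint.preimage _ (by simpa using hij)
  iUnion_cell := by ext x; simp

theorem entropyOfPartition_eq_entropyRate [IsProbabilityMeasure μ] (hT : Ergodic T μ)
    (P : FinPartition X k) {lab : X → Fin k} (hlab : Measurable lab)
    (hP : ∀ x j, x ∈ P.cell j ↔ lab x = j) :
    entropyOfPartition μ T P = (entropyRate μ T lab : ℝ) := by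
  have h : ∀ n, iterEntropy μ T P n = wordEntropy μ T lab n := fun n => by
    refine Finset.sum_congr rfl fun w _ => ?_
    rw [wordProb]
    congr 2
    ext x
    simp only [FinPartition.iterCell, Set.mem_iInter, Set.mem_preimage, hP, Set.mem_ofPred_eq,
      funext_iff, itinerary]
  simp only [entropyOfPartition, h]
  exact ((continuous_coe_real_ereal.tendsto _).comp (tendsto_wordEntropy_div hT hlab)).limsup_eq

end Partition

/-! ### Bounds for the covering number on the logarithmic scale. -/

section CoverNumber

variable {X : Type*} [MetricSpace X] [MeasurableSpace X] {μ : Measure X} {T : X → X}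
  {n : ℕ} {r δ a : ℝ}

theorem le_log_coverNumber_div (hn : 0 < n)
    (h : ∀ A : Set X, MeasurableSet A → 1 - δ < μ.real A → ∀ C : Finset X,
      A ⊆ ⋃ x ∈ C, dynBall T n x r → Real.exp (n * a) ≤ C.card) :
    (a : EReal) ≤ ENNReal.log (coverNumber μ T n r δ : ℝ≥0∞) / (n : EReal) := by
  -- Rounding up turns the real bound on cardinalities into one that passes to an infimum in `ℕ∞`.
  have h1 : ((⌈Real.exp (n * a)⌉₊ : ℕ) : ℕ∞) ≤ coverNumber μ T n r δ := by
    refine le_iInf fun A => le_iInf fun hA => le_iInf fun C => le_iInf fun hC => ?_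
    exact_mod_cast Nat.ceil_le.2 (h A hA.1 hA.2 C hC)
  have h2 : ENNReal.ofReal (Real.exp (n * a)) ≤ (coverNumber μ T n r δ : ℝ≥0∞) := by
    refine le_trans ?_ (ENat.toENNReal_mono h1)
    rw [ENat.toENNReal_coe, ← ENNReal.ofReal_natCast]
    exact ENNReal.ofReal_le_ofReal (Nat.le_ceil _)
  have h3 := ENNReal.log_monotone h2
  rw [ENNReal.log_ofReal_of_pos (Real.exp_pos _), Real.log_exp] at h3
  rw [EReal.le_div_iff_mul_le (by exact_mod_cast hn) (EReal.natCast_ne_top n)]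
  refine le_trans (le_of_eq ?_) h3
  rw [mul_comm (n : ℝ)]
  push_cast
  rfl

theorem log_coverNumber_div_le (hn : 0 < n) {A : Set X} (hA : MeasurableSet A)
    (hμA : 1 - δ < μ.real A) (C : Finset X) (hC : A ⊆ ⋃ x ∈ C, dynBall T n x r)
    (h : (C.card : ℝ) ≤ Real.exp (n * a)) :
    ENNReal.log (coverNumber μ T n r δ : ℝ≥0∞) / (n : EReal) ≤ a := by
  have h1 : coverNumber μ T n r δ ≤ (C.card : ℕ∞) :=
    iInf_le_of_le A <| iInf_le_of_le ⟨hA, hμA⟩ <| iInf_le_of_le C <| iInf_le_of_le hC le_rfl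
  have h2 : (coverNumber μ T n r δ : ℝ≥0∞) ≤ ENNReal.ofReal (Real.exp (n * a)) := by
    refine (ENat.toENNReal_mono h1).trans ?_
    rw [ENat.toENNReal_coe, ← ENNReal.ofReal_natCast]
    exact ENNReal.ofReal_le_ofReal h
  have h3 := ENNReal.log_monotone h2
  rw [ENNReal.log_ofReal_of_pos (Real.exp_pos _), Real.log_exp] at h3
  rw [EReal.div_le_iff_le_mul (by exact_mod_cast hn) (EReal.natCast_ne_top n)]
  refine h3.trans (le_of_eq ?_)
  push_cast
  rfl

end CoverNumber

/-! ### Frequency of visits to a set of small measure. -/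

section Visits

variable {X : Type*} {T : X → X}

/-- The number of visits to `F` of the orbit of `x` before the time `n`. -/
noncomputable def visits (T : X → X) (F : Set X) (n : ℕ) (x : X) : ℝ :=
  ∑ i ∈ Finset.range n, F.indicator 1 (T^[i] x)

theorem card_le_visits {F : Set X} {n : ℕ} {x : X} {s : Finset ℕ}
    (hs : ∀ i ∈ s, i < n ∧ T^[i] x ∈ F) : (s.card : ℝ) ≤ visits T F n x := by
  have h1 : (s.card : ℝ) = ∑ i ∈ s, F.indicator 1 (T^[i] x) := by
    rw [Finset.sum_congr rfl fun i hi => Set.indicator_of_mem (hs i hi).2 1]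
    simp
  rw [h1]
  exact Finset.sum_le_sum_of_subset_of_nonneg (fun i hi => Finset.mem_range.2 (hs i hi).1)
    fun i _ _ => Set.indicator_nonneg (fun _ _ => zero_le_one) _

variable [MeasurableSpace X] {μ : Measure X}

theorem measurable_visits (hT : Measurable T) {F : Set X} (hF : MeasurableSet F) (n : ℕ) :
    Measurable (visits T F n) :=
  Finset.measurable_sum _ fun i _ => (measurable_one.indicator hF).comp (hT.iterate i)

/-- Markov's inequality for the number of visits, whose mean is `n μ(F)` by invariance. The bound is
uniform in `n`, and no ergodic theorem is needed. -/
theorem measureReal_visits_gt_le [IsProbabilityMeasure μ] (hT : MeasurePreserving T μ μ)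
    {F : Set X} (hF : MeasurableSet F) {a b : ℝ} (ha : 0 < a) (hb : μ.real F ≤ a * b) {n : ℕ}
    (hn : 0 < n) : μ.real {x | n * a < visits T F n x} ≤ b := by
  have hi : ∀ i ∈ Finset.range n, Integrable (fun x => F.indicator (1 : X → ℝ) (T^[i] x)) μ :=
    fun i _ => (hT.iterate i).integrable_comp_of_integrable
      ((integrable_const (1 : ℝ)).indicator hF)
  have hint : ∫ x, visits T F n x ∂μ = n * μ.real F := by
    unfold visits
    rw [integral_finsetSum _ hi]
    have : ∀ i ∈ Finset.range n, ∫ x, F.indicator (1 : X → ℝ) (T^[i] x) ∂μ = μ.real F := by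
      intro i _
      have h := integral_map (μ := μ) (hT.iterate i).measurable.aemeasurable
        (f := F.indicator (1 : X → ℝ)) (measurable_one.indicator hF).aestronglyMeasurable
      rw [(hT.iterate i).map_eq, integral_indicator_one hF] at h
      exact h.symm
    rw [Finset.sum_congr rfl this]
    simp
  have hnn : 0 ≤ᵐ[μ] visits T F n := Eventually.of_forall fun x =>
    Finset.sum_nonneg fun i _ => Set.indicator_nonneg (fun _ _ => zero_le_one) _
  have hM := mul_meas_ge_le_integral_of_nonneg hnn (integrable_finsetSum _ hi) (n * a)
  have hna : 0 < n * a := by positivity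
  have h2 : n * a * μ.real {x | n * a < visits T F n x} ≤ n * a * b := by
    refine le_trans (mul_le_mul_of_nonneg_left (measureReal_mono fun x hx => ?_) hna.le)
      (hM.trans ?_)
    · exact le_of_lt (show n * a < visits T F n x from hx)
    · have hn' : (0 : ℝ) < n := by exact_mod_cast hn
      calc ∫ x, visits T F n x ∂μ = n * μ.real F := hint
        _ ≤ n * (a * b) := by gcongr
        _ = n * a * b := by ring
  exact le_of_mul_le_mul_left h2 hna

end Visits

/-! ### The size of Hamming balls. -/

section Hamming

variable {A : Type*} [Fintype A] [DecidableEq A]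

/-- Weight each word by `θ` to the power of its distance to `w₀`. The total weight factorizes over
positions, each factor being at most `1 + |A| θ`, while every word of `W` weighs at least `θ ^ (α
n)`. -/
theorem card_hammingBall_le {n : ℕ} (w₀ : Fin n → A) {θ α : ℝ} (hθ : 0 < θ) (hθ1 : θ ≤ 1)
    (W : Finset (Fin n → A)) (hW : ∀ w ∈ W, (hammingDist w w₀ : ℝ) ≤ α * n) :
    (W.card : ℝ) ≤ Real.exp (n * (α * -Real.log θ + Fintype.card A * θ)) := by
  have h1 : ∀ w : Fin n → A, θ ^ hammingDist w w₀ = ∏ i, if w i ≠ w₀ i then θ else 1 := by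
    intro w
    rw [Finset.prod_ite, Finset.prod_const, Finset.prod_const_one, mul_one]
    rfl
  have h2 : ∑ w : Fin n → A, θ ^ hammingDist w w₀ ≤ Real.exp (n * (Fintype.card A * θ)) := by
    simp_rw [h1]
    rw [← Fintype.piFinset_univ, ← Finset.prod_univ_sum (fun _ => Finset.univ)
      fun i a => if a ≠ w₀ i then θ else 1]
    have h3 : ∀ i, ∑ a : A, (if a ≠ w₀ i then θ else 1) ≤ Real.exp (Fintype.card A * θ) := by
      intro i
      have : ∀ a : A, (if a ≠ w₀ i then θ else 1) ≤ θ + if a = w₀ i then 1 else 0 := by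
        intro a
        by_cases h : a = w₀ i <;> simp [h, hθ.le]
      refine (Finset.sum_le_sum fun a _ => this a).trans ?_
      rw [Finset.sum_add_distrib]
      simp only [Finset.sum_const, Finset.card_univ, nsmul_eq_mul, Finset.sum_ite_eq',
        Finset.mem_univ, if_true]
      exact Real.add_one_le_exp _
    refine (Finset.prod_le_prod (fun i _ => Finset.sum_nonneg fun a _ => ?_)
      fun i _ => h3 i).trans ?_
    · split_ifs <;> positivity
    · rw [Finset.prod_const, Finset.card_univ, Fintype.card_fin, ← Real.exp_nat_mul]
  have h4 : (W.card : ℝ) * Real.exp (α * n * Real.log θ) ≤ Real.exp (n * (Fintype.card A * θ)) := by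
    refine le_trans ?_ h2
    rw [← nsmul_eq_mul]
    refine le_trans (Finset.card_nsmul_le_sum W (fun w => θ ^ hammingDist w w₀) _ fun w hw => ?_)
      (Finset.sum_le_sum_of_subset_of_nonneg (Finset.subset_univ _) fun w _ _ => by positivity)
    rw [← Real.exp_log (pow_pos hθ _), Real.log_pow]
    exact Real.exp_le_exp.2 (mul_le_mul_of_nonpos_right (hW w hw) (Real.log_nonpos hθ.le hθ1))
  rw [← le_div_iff₀ (Real.exp_pos _), ← Real.exp_sub] at h4
  refine h4.trans (le_of_eq ?_)
  congr 1
  ring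

end Hamming

/-! ### Entropy is at most the `δ`-entropy. -/

section LowerBound

variable {X A : Type*} [MetricSpace X] [MeasurableSpace X] [BorelSpace X]
  [SecondCountableTopology X] [CompleteSpace X] {μ : Measure X} [IsProbabilityMeasure μ]
  [Fintype A] [MeasurableSpace A] [MeasurableSingletonClass A] {lab : X → A}

/-- A measurable map with finitely many values is locally constant at a uniform scale on a compact
set of measure almost one. -/
theorem exists_isCompact_uniform_label (hlab : Measurable lab) {η : ℝ} (hη : 0 < η) :
    ∃ K : Set X, IsCompact K ∧ μ.real Kᶜ ≤ η ∧
      ∃ ρ > 0, ∀ x ∈ K, ∀ y ∈ K, dist x y < ρ → lab x = lab y := by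
  classical
  have : Nonempty A := ⟨lab (nonempty_of_isProbabilityMeasure μ).some⟩
  have hcard : (0 : ℝ) < Fintype.card A := by exact_mod_cast Fintype.card_pos
  have hpos : ENNReal.ofReal (η / Fintype.card A) ≠ 0 := by
    simpa using div_pos hη hcard
  have h : ∀ j, ∃ K ⊆ lab ⁻¹' {j}, IsCompact K ∧
      μ (lab ⁻¹' {j} \ K) < ENNReal.ofReal (η / Fintype.card A) := fun j =>
    (hlab (measurableSet_singleton j)).exists_isCompact_sdiff_lt (measure_ne_top μ _) hpos
  choose K hKsub hK hμK using h
  have hc : IsCompact (⋃ j, K j) := isCompact_iUnion hK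
  refine ⟨⋃ j, K j, hc, ?_, ?_⟩
  · have hsub : (⋃ j, K j)ᶜ ⊆ ⋃ j, (lab ⁻¹' {j} \ K j) := fun x hx => by
      simp only [Set.mem_compl_iff, Set.mem_iUnion, not_exists] at hx
      exact Set.mem_iUnion.2 ⟨lab x, rfl, hx _⟩
    refine (measureReal_mono hsub).trans ((measureReal_iUnion_fintype_le _).trans ?_)
    have hj : ∀ j, μ.real (lab ⁻¹' {j} \ K j) ≤ η / Fintype.card A := fun j =>
      ENNReal.toReal_le_of_le_ofReal (by positivity) (hμK j).le
    refine (Finset.sum_le_sum fun j _ => hj j).trans (le_of_eq ?_)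
    rw [Finset.sum_const, Finset.card_univ, nsmul_eq_mul, mul_div_cancel₀ _ hcard.ne']
  -- The `j`-th open set is the complement of the pieces with another label, so a ball contained in
  -- it meets the compact set only in `K j`.
  · obtain ⟨ρ, hρ, hball⟩ := lebesgue_number_lemma_of_metric (s := ⋃ j, K j)
      (c := fun j => (⋃ i ∈ {i | i ≠ j}, K i)ᶜ) hc
      (fun j => ((Set.toFinite {i | i ≠ j}).isClosed_biUnion
        fun i _ => (hK i).isClosed).isOpen_compl) (fun x hx => by
        obtain ⟨j, hj⟩ := Set.mem_iUnion.1 hx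
        refine Set.mem_iUnion.2 ⟨j, fun hx' => ?_⟩
        obtain ⟨i, hi, hxi⟩ := Set.mem_iUnion₂.1 hx'
        exact hi ((hKsub i hxi : lab x = i).symm.trans (hKsub j hj)))
    refine ⟨ρ, hρ, fun x hx y hy hxy => ?_⟩
    obtain ⟨j, hj⟩ := hball x hx
    have key : ∀ z ∈ ⋃ j, K j, z ∈ Metric.ball x ρ → lab z = j := fun z hz hzb => by
      obtain ⟨i, hi⟩ := Set.mem_iUnion.1 hz
      by_contra hne
      refine hj hzb (Set.mem_iUnion₂.2 ⟨i, ?_, hi⟩)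
      exact fun h => hne ((hKsub i hi : lab z = i).trans h)
    rw [key x hx (Metric.mem_ball_self hρ), key y hy (by rwa [Metric.mem_ball, dist_comm])]

theorem exists_hamming_parameters (N : ℕ) {ε : ℝ} (hε : 0 < ε) :
    ∃ θ α : ℝ, 0 < θ ∧ θ ≤ 1 ∧ 0 < α ∧ α * -Real.log θ + N * θ ≤ ε := by
  -- First `θ` makes `N * θ` small; then `α` is chosen small against `-log θ`.
  set θ := min 1 (ε / (2 * (N + 1))) with hθ
  have hθ0 : 0 < θ := lt_min one_pos (by positivity)
  have hθ1 : θ ≤ 1 := min_le_left _ _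
  have hlog : 0 ≤ -Real.log θ := neg_nonneg.2 (Real.log_nonpos hθ0.le hθ1)
  refine ⟨θ, ε / (2 * (-Real.log θ + 1)), hθ0, hθ1, by positivity, ?_⟩
  have h1 : ε / (2 * (-Real.log θ + 1)) * -Real.log θ ≤ ε / 2 := by
    rw [div_mul_eq_mul_div, div_le_iff₀ (by positivity)]
    nlinarith
  have h2 : N * θ ≤ ε / 2 := by
    have : θ ≤ ε / (2 * (N + 1)) := min_le_right _ _
    rw [le_div_iff₀ (by positivity)] at this
    nlinarith
  linarith

/-- The entropy of a partition is at most the lower `δ`-entropy. -/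
theorem entropyRate_le_lowerDeltaEntropy {T : X → X} (hT : Ergodic T μ) (hlab : Measurable lab)
    {δ : ℝ} (hδ : δ < 1) : (entropyRate μ T lab : EReal) ≤ lowerDeltaEntropy μ T δ := by
  classical
  have hTm := hT.toMeasurePreserving.measurable
  refine EReal.ge_of_forall_gt_iff_ge.1 fun b hb => ?_
  have hb' : b < entropyRate μ T lab := by exact_mod_cast hb
  set ε := entropyRate μ T lab - b with hεdef
  have hε : 0 < ε := sub_pos.2 hb'
  obtain ⟨θ, α, hθ, hθ1, hα, hsmall⟩ := exists_hamming_parameters (Fintype.card A) (half_pos hε)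
  -- Half of the mass `1 - δ` is given up to the points that leave `K` too often; the other half
  -- must still be carried by words.
  set c := (1 - δ) / 2 with hc
  have hc0 : 0 < c := by rw [hc]; linarith
  obtain ⟨K, hK, hKμ, ρ, hρ, hunif⟩ := exists_isCompact_uniform_label (μ := μ) hlab
    (show 0 < α / 2 * c by positivity)
  refine le_trans ?_ (le_iSup₂ (f := fun (r : ℝ) (_ : 0 < r) => lowerDeltaEntropyAt μ T δ r)
    (ρ / 2) (half_pos hρ))
  refine le_liminf_of_le (by isBoundedDefault) ?_
  filter_upwards [eventually_gt_atTop 0, exp_entropyRate_le_card hT hlab hc0 (half_pos hε)]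
    with n hn hcard
  refine le_log_coverNumber_div hn fun S hS hμS C hC => ?_
  set G := {x | visits T Kᶜ n x ≤ n * (α / 2)} with hG
  have hGm : MeasurableSet G :=
    measurableSet_le (measurable_visits hTm hK.measurableSet.compl n) measurable_const
  have hGc : μ.real Gᶜ ≤ c := by
    have : Gᶜ = {x | n * (α / 2) < visits T Kᶜ n x} := by
      ext x; simp [hG]
    rw [this]
    exact measureReal_visits_gt_le hT.toMeasurePreserving hK.measurableSet.compl (by positivity)
      hKμ hn
  -- The itineraries of the good points of a ball. The centre `x` need not be good, so Hamming
  -- distances are measured from the itinerary of some good `y₀`; the radius `ρ / 2` keeps two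
  -- points of the ball within `ρ` of each other.
  set V : X → Finset (Fin n → A) := fun x =>
    Finset.univ.filter fun w => ∃ y ∈ dynBall T n x (ρ / 2) ∩ G, itinerary T lab n y = w with hV
  have hVcard : ∀ x, ((V x).card : ℝ) ≤ Real.exp (n * (ε / 2)) := by
    intro x
    rcases (V x).eq_empty_or_nonempty with h | ⟨w₀, hw₀⟩
    · rw [h]; simp [(Real.exp_pos _).le]
    obtain ⟨y₀, ⟨hy₀, hy₀G⟩, rfl⟩ := (Finset.mem_filter.1 hw₀).2
    refine (card_hammingBall_le (itinerary T lab n y₀) hθ hθ1 (V x) (α := α) ?_).trans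
      (Real.exp_le_exp.2 (mul_le_mul_of_nonneg_left hsmall n.cast_nonneg))
    intro w hw
    obtain ⟨y, ⟨hy, hyG⟩, rfl⟩ := (Finset.mem_filter.1 hw).2
    set s₁ := (Finset.range n).filter fun i => T^[i] y ∈ Kᶜ
    set s₂ := (Finset.range n).filter fun i => T^[i] y₀ ∈ Kᶜ
    have h1 : (s₁.card : ℝ) ≤ n * (α / 2) := (card_le_visits fun i hi => by
      simpa [s₁] using hi).trans hyG
    have h2 : (s₂.card : ℝ) ≤ n * (α / 2) := (card_le_visits fun i hi => by
      simpa [s₂] using hi).trans hy₀G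
    -- When both orbits are in `K`, they are `ρ`-close and so have the same label.
    have h3 : hammingDist (itinerary T lab n y) (itinerary T lab n y₀) ≤ (s₁ ∪ s₂).card := by
      rw [hammingDist]
      refine Finset.card_le_card_of_injOn (fun i => (i : ℕ)) (fun i hi => ?_)
        (fun i _ j _ h => Fin.ext h)
      by_contra hcon
      simp only [s₁, s₂, Finset.coe_union, Finset.coe_filter, Set.mem_union, Set.mem_ofPred_eq,
        Finset.mem_range, i.2, true_and, not_or, Set.mem_compl_iff, not_not] at hcon
      simp only [Finset.coe_filter, Finset.mem_univ, true_and, Set.mem_ofPred_eq] at hi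
      refine hi (hunif _ hcon.1 _ hcon.2 ?_)
      have t1 := hy i i.2
      have t2 := hy₀ i i.2
      have t3 := dist_triangle_left (T^[i] y) (T^[i] y₀) (T^[i] x)
      linarith
    have h4 : ((s₁ ∪ s₂).card : ℝ) ≤ s₁.card + s₂.card := by
      exact_mod_cast Finset.card_union_le _ _
    have h5 : (hammingDist (itinerary T lab n y) (itinerary T lab n y₀) : ℝ) ≤ (s₁ ∪ s₂).card := by
      exact_mod_cast h3
    linarith
  have hsub : S ⊆ {x | itinerary T lab n x ∈ C.biUnion V} ∪ Gᶜ := by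
    intro y hy
    by_cases hyG : y ∈ G
    · obtain ⟨x, hx, hyx⟩ := Set.mem_iUnion₂.1 (hC hy)
      refine Or.inl (Finset.mem_biUnion.2 ⟨x, hx, ?_⟩)
      exact Finset.mem_filter.2 ⟨Finset.mem_univ _, y, ⟨hyx, hyG⟩, rfl⟩
    · exact Or.inr hyG
  have hW := hcard (C.biUnion V) (by
    have h1 := (measureReal_mono (μ := μ) hsub).trans (measureReal_union_le _ _)
    linarith)
  have h6 : ((C.biUnion V).card : ℝ) ≤ C.card * Real.exp (n * (ε / 2)) := by
    have : ((C.biUnion V).card : ℝ) ≤ ∑ x ∈ C, ((V x).card : ℝ) := by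
      exact_mod_cast Finset.card_biUnion_le
    refine this.trans ((Finset.sum_le_sum fun x _ => hVcard x).trans (le_of_eq ?_))
    rw [Finset.sum_const, nsmul_eq_mul]
  have h7 := hW.trans h6
  rw [← div_le_iff₀ (Real.exp_pos _), ← Real.exp_sub] at h7
  refine le_trans (le_of_eq ?_) h7
  congr 1
  rw [hεdef]
  ring

end LowerBound

/-! ### Absences from a set of times, and recurrence. -/

section Gaps

open Classical in
/-- The time to wait after `t` until the next time in `V`, truncated at the horizon `n`. -/
noncomputable def gap (n : ℕ) (V : ℕ → Prop) (t : ℕ) : ℕ :=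
  Nat.find (p := fun s => 0 < s ∧ (n ≤ t + s ∨ V (t + s)))
    ⟨n + 1, Nat.succ_pos n, Or.inl (by omega)⟩

variable {n : ℕ} {V : ℕ → Prop}

theorem gap_pos (t : ℕ) : 0 < gap n V t := by
  classical
  exact (Nat.find_spec (p := fun s => 0 < s ∧ (n ≤ t + s ∨ V (t + s))) _).1

theorem gap_le {t s : ℕ} (hs : 0 < s) (hV : V (t + s)) : gap n V t ≤ s := by
  classical
  exact Nat.find_min' _ ⟨hs, Or.inr hV⟩

theorem lt_and_not_of_lt_gap {t s : ℕ} (hs : 0 < s) (h : s < gap n V t) :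
    t + s < n ∧ ¬V (t + s) := by
  classical
  have := Nat.find_min (p := fun s => 0 < s ∧ (n ≤ t + s ∨ V (t + s))) _ h
  simpa [hs] using this

theorem lt_gap {t m : ℕ} (h : ∀ s, 0 < s → s ≤ m → t + s < n ∧ ¬V (t + s)) : m < gap n V t := by
  classical
  rw [gap, Nat.lt_find_iff]
  rintro s hs ⟨hs0, h' | h'⟩
  · exact absurd (h s hs0 hs).1 (not_lt.2 h')
  · exact (h s hs0 hs).2 h'

open Classical in
/-- The total length of the long gaps is controlled by the number of the times which are followed by
a long absence from `V`. -/
theorem sum_gap_le {q : ℕ} (hq : 0 < q) :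
    ∑ t ∈ (Finset.range n).filter (fun t => V t ∧ 2 * q < gap n V t), gap n V t ≤
      2 * ((Finset.range n).filter fun j => ∀ i < q, j + i < n ∧ ¬V (j + i)).card := by
  set S := (Finset.range n).filter (fun t => V t ∧ 2 * q < gap n V t) with hS
  -- A gap `g > 2q` is at most `2 (g - q)`. The `g - q` times in the interval are those after `t`
  -- whose next `q` times, counting themselves, stay inside the gap.
  have h1 : ∑ t ∈ S, gap n V t ≤
      2 * ∑ t ∈ S, (Finset.Ioc t (t + gap n V t - q)).card := by
    rw [Finset.mul_sum]
    refine Finset.sum_le_sum fun t ht => ?_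
    have := (Finset.mem_filter.1 ht).2.2
    rw [Nat.card_Ioc]
    omega
  refine h1.trans (Nat.mul_le_mul_left 2 ?_)
  have hlt : ∀ t t', t < t' → V t' →
      Disjoint (Finset.Ioc t (t + gap n V t - q)) (Finset.Ioc t' (t' + gap n V t' - q)) := by
    intro t t' htt hV
    rw [Finset.disjoint_left]
    intro j hj hj'
    have := gap_le (n := n) (V := V) (t := t) (s := t' - t) (by omega)
      (by rwa [Nat.add_sub_cancel' htt.le])
    simp only [Finset.mem_Ioc] at hj hj'
    omega
  rw [← Finset.card_biUnion]
  · refine Finset.card_le_card fun j hj => ?_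
    obtain ⟨t, ht, hjt⟩ := Finset.mem_biUnion.1 hj
    have hgap := (Finset.mem_filter.1 ht).2.2
    rw [Finset.mem_Ioc] at hjt
    have key : ∀ i < q, j + i < n ∧ ¬V (j + i) := by
      intro i hi
      have := lt_and_not_of_lt_gap (n := n) (V := V) (t := t) (s := j + i - t) (by omega) (by omega)
      rwa [show t + (j + i - t) = j + i by omega] at this
    exact Finset.mem_filter.2 ⟨Finset.mem_range.2 (by have := (key 0 hq).1; omega), key⟩
  · intro t ht t' ht' hne
    rcases lt_or_gt_of_ne hne with h | h
    · exact hlt t t' h (Finset.mem_filter.1 ht').2.1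
    · exact (hlt t' t h (Finset.mem_filter.1 ht).2.1).symm

/-- The times before `n` at which the word `w` has not the letter `a₀`. -/
def wordVisit {A : Type*} {n : ℕ} (a₀ : A) (w : Fin n → A) (i : ℕ) : Prop :=
  ∃ h : i < n, w ⟨i, h⟩ ≠ a₀

theorem wordVisit_itinerary {X A : Type*} {T : X → X} {K : Set X} {lab : X → A} {a₀ : A}
    (h₀ : ∀ x, lab x ≠ a₀ ↔ x ∈ K) {n i : ℕ} (hi : i < n) (x : X) :
    wordVisit a₀ (itinerary T lab n x) i ↔ T^[i] x ∈ K := by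
  simp only [wordVisit, itinerary, hi, exists_true_left, h₀]

end Gaps

/-- Almost every orbit of an ergodic map visits a set of positive measure. -/
theorem tendsto_measureReal_avoid {X : Type*} [MeasurableSpace X] {μ : Measure X}
    [IsProbabilityMeasure μ] {T : X → X}
    (hT : Ergodic T μ) {K : Set X} (hK : MeasurableSet K) (hμK : 0 < μ.real K) :
    Tendsto (fun q : ℕ => μ.real {x | ∀ i < q, T^[i] x ∉ K}) atTop (𝓝 0) := by
  have hTm := hT.toMeasurePreserving.measurable
  have hm : ∀ q : ℕ, MeasurableSet {x | ∀ i < q, T^[i] x ∉ K} := fun q => by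
    have : {x | ∀ i < q, T^[i] x ∉ K} = ⋂ i ∈ Finset.range q, T^[i] ⁻¹' Kᶜ := by
      ext x; simp
    rw [this]
    exact Finset.measurableSet_biInter _ fun i _ => hTm.iterate i hK.compl
  have hanti : Antitone fun q : ℕ => {x | ∀ i < q, T^[i] x ∉ K} :=
    fun p q hpq x hx i hi => hx i (hi.trans_le hpq)
  have h := tendsto_measure_iInter_atTop (μ := μ) (fun q => (hm q).nullMeasurableSet) hanti
    ⟨0, measure_ne_top μ _⟩
  set F := ⋂ q : ℕ, {x | ∀ i < q, T^[i] x ∉ K} with hF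
  have hFm : MeasurableSet F := MeasurableSet.iInter hm
  -- Avoiding `K` forever persists after one step, so ergodicity makes `F` null or full; it cannot
  -- be full, since it misses `K`.
  have hFsub : F ⊆ T ⁻¹' F := by
    intro x hx
    simp only [hF, Set.mem_preimage, Set.mem_iInter, Set.mem_ofPred_eq] at hx ⊢
    intro q i hi
    rw [← Function.iterate_succ_apply]
    exact hx (q + 1) (i + 1) (by omega)
  have hF0 : μ F = 0 := by
    rcases hT.ae_empty_or_univ_of_ae_le_preimage hFm.nullMeasurableSet
      hFsub.eventuallyLE with h0 | h0
    · rw [measure_congr h0, measure_empty]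
    · exfalso
      have hFK : F ⊆ Kᶜ := fun x hx => by
        simp only [hF, Set.mem_iInter, Set.mem_ofPred_eq] at hx
        exact hx 1 0 one_pos
      have h1 : μ.real F = 1 := by rw [measureReal_congr h0, probReal_univ]
      have h2 := measureReal_mono (μ := μ) hFK
      rw [probReal_compl_eq_one_sub hK] at h2
      linarith
  rw [hF0] at h
  exact (ENNReal.tendsto_toReal ENNReal.zero_ne_top).comp h

/-! ### Box dimension, codes and shadowing through long absences. -/

section UpperBound

variable {X : Type*} [MetricSpace X]

/-- At each scale `ρ`, the set `K` is covered by at most `C ρ ^ (-D)` sets of diameter less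
than `ρ`. -/
def FiniteBoxDim (K : Set X) : Prop :=
  ∃ (C : ℝ) (D : ℕ), 1 ≤ C ∧ ∀ ρ : ℝ, 0 < ρ → ρ ≤ 1 → ∃ (N : ℕ) (f : X → ℕ),
    (N : ℝ) ≤ C * ρ⁻¹ ^ D ∧ (∀ x ∈ K, f x < N) ∧ ∀ x ∈ K, ∀ y ∈ K, f x = f y → dist x y < ρ

/-- At scale `r / L ^ s` a power law in the scale becomes an exponential in `s`: with `B = C r⁻¹ ^ D
≥ 1`, the count is at most `B * L ^ (s D) ≤ (B * L ^ D) ^ s` for `s > 0`. Thus the cost of a code is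
linear in the length of the absence. -/
theorem FiniteBoxDim.exists_code {K : Set X} (hK : FiniteBoxDim K) {r L : ℝ} (hr : 0 < r)
    (hr1 : r ≤ 1) (hL : 1 ≤ L) : ∃ Γ : ℝ, 0 ≤ Γ ∧ ∃ (N : ℕ → ℕ) (f : ℕ → X → ℕ), ∀ s, 0 < s →
      (N s : ℝ) ≤ Real.exp (s * Γ) ∧ (∀ x ∈ K, f s x < N s) ∧
      ∀ x ∈ K, ∀ y ∈ K, f s x = f s y → L ^ s * dist x y < r := by
  obtain ⟨C, D, hC, h⟩ := hK
  have hL0 : 0 < L := by linarith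
  have hρ : ∀ s : ℕ, 0 < r / L ^ s ∧ r / L ^ s ≤ 1 := fun s =>
    ⟨by positivity, div_le_one_of_le₀ (hr1.trans (one_le_pow₀ hL)) (by positivity)⟩
  choose N f hN hf hd using fun s : ℕ => h (r / L ^ s) (hρ s).1 (hρ s).2
  set B := C * r⁻¹ ^ D with hB
  have hB1 : 1 ≤ B := one_le_mul_of_one_le_of_one_le hC (one_le_pow₀ (one_le_inv_iff₀.2 ⟨hr, hr1⟩))
  have hB0 : 0 < B := by linarith
  refine ⟨Real.log B + D * Real.log L, add_nonneg (Real.log_nonneg hB1)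
    (mul_nonneg D.cast_nonneg (Real.log_nonneg hL)), N, f, fun s hs => ⟨?_, hf s, ?_⟩⟩
  · refine (hN s).trans ?_
    have h1 : Real.exp (s * (Real.log B + D * Real.log L)) = B ^ s * (L ^ s) ^ D := by
      rw [mul_add, Real.exp_add, Real.exp_nat_mul, Real.exp_log hB0, ← mul_assoc,
        ← Nat.cast_mul, Real.exp_nat_mul, Real.exp_log hL0, pow_mul]
    rw [h1, inv_div, div_eq_mul_inv, mul_pow, mul_comm ((L ^ s) ^ D), ← mul_assoc]
    exact mul_le_mul_of_nonneg_right (le_self_pow₀ hB1 hs.ne') (by positivity)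
  · intro x hx y hy hxy
    have := hd s x hx y hy hxy
    rwa [lt_div_iff₀ (by positivity), mul_comm] at this

/-- A set on which the dynamical balls are separated by a code with values in a finite set is covered
by at most as many dynamical balls as there are codes. -/
theorem exists_finset_cover {ι : Type*} {T : X → X} {n : ℕ} {r : ℝ} (Z : Set X) (e : X → ι)
    (I : Finset ι) (he : ∀ x ∈ Z, e x ∈ I)
    (hr : ∀ x ∈ Z, ∀ y ∈ Z, e x = e y → y ∈ dynBall T n x r) :
    ∃ C : Finset X, C.card ≤ I.card ∧ Z ⊆ ⋃ x ∈ C, dynBall T n x r := by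
  classical
  rcases Z.eq_empty_or_nonempty with rfl | ⟨z₀, _⟩
  · exact ⟨∅, by simp, Set.empty_subset _⟩
  let c : ι → X := fun i => if h : ∃ x ∈ Z, e x = i then h.choose else z₀
  refine ⟨I.image c, Finset.card_image_le, fun y hy => ?_⟩
  have h : ∃ x ∈ Z, e x = e y := ⟨y, hy, rfl⟩
  have hc : c (e y) = h.choose := dif_pos h
  refine Set.mem_iUnion₂.2 ⟨c (e y), Finset.mem_image_of_mem _ (he y hy), ?_⟩
  rw [hc]
  exact hr _ h.choose_spec.1 _ hy h.choose_spec.2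

/-- Two points with the same itinerary, whose orbits are close enough at the visits to `K` followed
by a long excursion, stay close. -/
theorem mem_dynBall_of_itinerary_eq {A : Type*} {T : X → X} {L : NNReal} (hL : 1 ≤ L)
    (hT : LipschitzWith L T) {K : Set X} {lab : X → A} {a₀ : A} (h₀ : ∀ x, lab x ≠ a₀ ↔ x ∈ K)
    {q n : ℕ} {r : ℝ}
    (hlab : ∀ x ∈ K, ∀ y ∈ K, lab x = lab y → (L : ℝ) ^ (2 * q) * dist x y < r) {x y : X}
    (hx : x ∈ K) (hxy : itinerary T lab n x = itinerary T lab n y)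
    (hgap : ∀ t < n, T^[t] x ∈ K → T^[t] y ∈ K →
      2 * q < gap n (wordVisit a₀ (itinerary T lab n x)) t →
      (L : ℝ) ^ gap n (wordVisit a₀ (itinerary T lab n x)) t * dist (T^[t] x) (T^[t] y) < r) :
    y ∈ dynBall T n x r := by
  classical
  intro i hi
  set V := wordVisit a₀ (itinerary T lab n x) with hV
  have hV0 : V 0 := (wordVisit_itinerary h₀ (by omega) x).2 hx
  -- The last visit to `K` up to time `i`. It exists because `x ∈ K`, and `i - t` is less than the
  -- gap at `t`, so the separation at time `t` grows by at most `L ^ (i - t)`. Short gaps are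
  -- handled by the label, long ones by `hgap`.
  set t := Nat.findGreatest V i with ht
  have hti : t ≤ i := Nat.findGreatest_le i
  have hVt : V t := Nat.findGreatest_spec (Nat.zero_le i) hV0
  have htn : t < n := by omega
  have hxt : T^[t] x ∈ K := (wordVisit_itinerary h₀ htn x).1 hVt
  have hyt : T^[t] y ∈ K := by
    rw [hV, hxy] at hVt
    exact (wordVisit_itinerary h₀ htn y).1 hVt
  have hlt : i - t < gap n V t := lt_gap fun s hs hs' =>
    ⟨by omega, Nat.findGreatest_is_greatest (n := i) (by omega) (by omega)⟩
  have hL1 : (1 : ℝ) ≤ L := by exact_mod_cast hL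
  have hdist : dist (T^[i] x) (T^[i] y) ≤ (L : ℝ) ^ (i - t) * dist (T^[t] x) (T^[t] y) := by
    have := (hT.iterate (i - t)).dist_le_mul (T^[t] x) (T^[t] y)
    rw [← Function.iterate_add_apply, ← Function.iterate_add_apply, Nat.sub_add_cancel hti] at this
    simpa using this
  refine hdist.trans_lt ?_
  by_cases hlong : 2 * q < gap n V t
  · refine lt_of_le_of_lt ?_ (hgap t htn hxt hyt hlong)
    gcongr
  · have hl := hlab _ hxt _ hyt (congrFun hxy ⟨t, htn⟩)
    refine lt_of_le_of_lt ?_ hl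
    gcongr
    omega

variable [MeasurableSpace X] [BorelSpace X] [SecondCountableTopology X]

theorem exists_label_of_isCompact [Nonempty X] {K : Set X} (hK : IsCompact K) {ρ : ℝ}
    (hρ : 0 < ρ) : ∃ (k : ℕ) (lab : X → Fin (k + 1)), Measurable lab ∧ (∀ x, lab x ≠ 0 ↔ x ∈ K) ∧
      ∀ x ∈ K, ∀ y ∈ K, lab x = lab y → dist x y < ρ := by
  classical
  set e := TopologicalSpace.denseSeq X
  obtain ⟨s, hs⟩ := hK.elim_finite_subcover (fun i => Metric.ball (e i) (ρ / 2))
    (fun i => Metric.isOpen_ball) (fun x _ => by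
      obtain ⟨i, hi⟩ := (TopologicalSpace.denseRange_denseSeq X).exists_dist_lt x (half_pos hρ)
      exact Set.mem_iUnion.2 ⟨i, hi⟩)
  set N := s.sup id with hN
  set ind := SimpleFunc.nearestPtInd e N with hind
  -- The label `0` is reserved for the complement of `K`; in `K` it records the nearest of the
  -- points `e 0, …, e N`.
  refine ⟨N + 1, fun x => if x ∈ K then Fin.succ (Fin.ofNat (N + 1) (ind x)) else 0, ?_, ?_, ?_⟩
  · refine Measurable.ite hK.measurableSet ?_ measurable_const
    exact (measurable_of_countable fun m : ℕ => Fin.succ (Fin.ofNat (N + 1) m)).comp ind.measurable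
  · intro x
    by_cases hx : x ∈ K <;> simp [hx]
  · intro x hx y hy hxy
    simp only [hx, hy, if_true, Fin.succ_inj] at hxy
    have hle : ∀ z, ind z ≤ N := fun z => SimpleFunc.nearestPtInd_le e N z
    have hi : ind x = ind y := by
      have := congrArg Fin.val hxy
      simpa [Fin.ofNat, Nat.mod_eq_of_lt (Nat.lt_succ_of_le (hle _))] using this
    have key : ∀ z ∈ K, dist (e (ind z)) z < ρ / 2 := by
      intro z hz
      obtain ⟨i, his, hzi⟩ := Set.mem_iUnion₂.1 (hs hz)
      have h1 := SimpleFunc.edist_nearestPt_le e z (k := i) (N := N)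
        (Finset.le_sup (f := id) his)
      rw [edist_dist, edist_dist, ENNReal.ofReal_le_ofReal_iff dist_nonneg] at h1
      refine lt_of_le_of_lt h1 ?_
      rw [dist_comm]
      exact hzi
    have h1 := key x hx
    have h2 := key y hy
    rw [← hi] at h2
    have := dist_triangle_left x y (e (ind x))
    linarith

end UpperBound

/-! ### The `δ`-entropy is at most the entropy. -/

section UpperBound

variable {X : Type*} [MetricSpace X]

open Classical in
/-- The points whose orbit rarely makes a long excursion out of `K` are covered by few dynamical
balls, compared to the number of their itineraries. -/
theorem exists_cover_card_le {k : ℕ} {T : X → X} {L : NNReal} (hL : 1 ≤ L)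
    (hT : LipschitzWith L T) {K : Set X} {lab : X → Fin (k + 1)} (h₀ : ∀ x, lab x ≠ 0 ↔ x ∈ K)
    {q n : ℕ} (hq : 0 < q) {r Γ a : ℝ} (hΓ : 0 ≤ Γ)
    (hlab : ∀ x ∈ K, ∀ y ∈ K, lab x = lab y → (L : ℝ) ^ (2 * q) * dist x y < r)
    {N : ℕ → ℕ} {f : ℕ → X → ℕ} (hf : ∀ s, 0 < s → (N s : ℝ) ≤ Real.exp (s * Γ) ∧
      (∀ x ∈ K, f s x < N s) ∧ ∀ x ∈ K, ∀ y ∈ K, f s x = f s y → (L : ℝ) ^ s * dist x y < r)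
    (W : Finset (Fin n → Fin (k + 1))) :
    ∃ C : Finset X, (C.card : ℝ) ≤ W.card * Real.exp (n * (2 * a * Γ)) ∧
      K ∩ {x | itinerary T lab n x ∈ W} ∩
        {x | visits T {x | ∀ i < q, T^[i] x ∉ K} n x ≤ n * a} ⊆ ⋃ x ∈ C, dynBall T n x r := by
  set Z := K ∩ {x | itinerary T lab n x ∈ W} ∩
    {x | visits T {x | ∀ i < q, T^[i] x ∉ K} n x ≤ n * a} with hZ
  set long : (Fin n → Fin (k + 1)) → ℕ → Prop := fun w t =>
    wordVisit 0 w t ∧ 2 * q < gap n (wordVisit 0 w) t with hlong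
  set R : (Fin n → Fin (k + 1)) → Finset (Fin n → ℕ) := fun w =>
    Fintype.piFinset fun t : Fin n =>
      Finset.range (if long w t then N (gap n (wordVisit 0 w) t) else 1) with hR
  -- Only words realized in `Z` are kept: the bound on the total length of the long gaps of a word
  -- comes from such a point.
  set W' := W.filter fun w => ∃ x ∈ Z, itinerary T lab n x = w with hW'
  -- The code is the itinerary together with the position in `K` at the start of each long gap, to a
  -- precision adapted to its length. The word alone determines where these gaps are.
  set e : X → (Σ _ : Fin n → Fin (k + 1), Fin n → ℕ) := fun x =>
    ⟨itinerary T lab n x, fun t => if long (itinerary T lab n x) t then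
      f (gap n (wordVisit 0 (itinerary T lab n x)) t) (T^[t] x) else 0⟩ with he
  obtain ⟨C, hC, hZC⟩ := exists_finset_cover (T := T) (n := n) (r := r) Z e (W'.sigma R) (by
      intro x hx
      refine Finset.mem_sigma.2 ⟨Finset.mem_filter.2 ⟨hx.1.2, x, hx, rfl⟩, ?_⟩
      refine Fintype.mem_piFinset.2 fun t => ?_
      by_cases ht : long (itinerary T lab n x) t
      · simp only [he, ht, if_true, Finset.mem_range]
        exact (hf _ (gap_pos _)).2.1 _ ((wordVisit_itinerary h₀ t.2 x).1 ht.1)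
      · simp [he, ht]) (by
      intro x hx y hy hxy
      simp only [he, Sigma.mk.injEq, heq_eq_eq] at hxy
      refine mem_dynBall_of_itinerary_eq hL hT h₀ hlab hx.1.1 hxy.1 fun t ht hxt hyt hgt => ?_
      have hl : long (itinerary T lab n x) t := ⟨(wordVisit_itinerary h₀ ht x).2 hxt, hgt⟩
      have h2 := congrFun hxy.2 ⟨t, ht⟩
      rw [← hxy.1] at h2
      simp only [hl, if_true] at h2
      exact (hf _ (gap_pos _)).2.2 _ hxt _ hyt h2)
  refine ⟨C, ?_, hZC⟩
  have hRcard : ∀ w ∈ W', ((R w).card : ℝ) ≤ Real.exp (n * (2 * a * Γ)) := by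
    intro w hw
    obtain ⟨x, hx, rfl⟩ := (Finset.mem_filter.1 hw).2
    set w := itinerary T lab n x with hwdef
    rw [hR, Fintype.card_piFinset]
    simp only [Finset.card_range]
    rw [Fin.prod_univ_eq_prod_range
      (fun t => if long w t then N (gap n (wordVisit 0 w) t) else 1) n,
      ← Finset.prod_filter, Nat.cast_prod]
    refine (Finset.prod_le_prod (fun _ _ => Nat.cast_nonneg _)
      fun t _ => (hf _ (gap_pos t)).1).trans ?_
    rw [← Real.exp_sum, ← Finset.sum_mul]
    refine Real.exp_le_exp.2 ?_
    have hsum := sum_gap_le (n := n) (V := wordVisit 0 w) hq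
    have hvis : ((((Finset.range n).filter fun j =>
        ∀ i < q, j + i < n ∧ ¬wordVisit 0 w (j + i)).card : ℕ) : ℝ) ≤ n * a := by
      refine (card_le_visits fun j hj => ?_).trans hx.2
      obtain ⟨hjn, hj⟩ := Finset.mem_filter.1 hj
      refine ⟨Finset.mem_range.1 hjn, fun i hi => ?_⟩
      have := hj i hi
      rw [wordVisit_itinerary h₀ this.1] at this
      rw [← Function.iterate_add_apply, add_comm]
      exact this.2
    have hsum' : (∑ t ∈ (Finset.range n).filter (long w), (gap n (wordVisit 0 w) t : ℝ)) ≤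
        2 * (n * a) := by
      refine le_trans ?_ (mul_le_mul_of_nonneg_left hvis zero_le_two)
      exact_mod_cast hsum
    calc _ ≤ 2 * (n * a) * Γ := mul_le_mul_of_nonneg_right hsum' hΓ
      _ = _ := by ring
  have h1 : (C.card : ℝ) ≤ ∑ w ∈ W', ((R w).card : ℝ) := by
    rw [Finset.card_sigma] at hC
    exact_mod_cast hC
  refine h1.trans ((Finset.sum_le_sum hRcard).trans ?_)
  rw [Finset.sum_const, nsmul_eq_mul]
  refine mul_le_mul_of_nonneg_right ?_ (Real.exp_pos _).le
  exact_mod_cast Finset.card_filter_le _ _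

variable [MeasurableSpace X] [BorelSpace X] [SecondCountableTopology X] {μ : Measure X}
  [IsProbabilityMeasure μ]

/-- The lower `δ`-entropy of a Lipschitz map is at most its measure-theoretic entropy if compact
sets have finite box dimension. -/
theorem lowerDeltaEntropy_le_entropy [CompleteSpace X] {T : X → X} {L : NNReal}
    (hL : LipschitzWith L T) (hT : Ergodic T μ) (hbox : ∀ K : Set X, IsCompact K → FiniteBoxDim K)
    {δ : ℝ} (hδ : 0 < δ) : lowerDeltaEntropy μ T δ ≤ entropy μ T := by
  classical
  have hTm := hT.toMeasurePreserving.measurable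
  have : Nonempty X := nonempty_of_isProbabilityMeasure μ
  refine iSup₂_le fun r₀ hr₀ => EReal.le_of_forall_lt_iff_le.1 fun b hb => ?_
  obtain ⟨b', hb', hbb⟩ := EReal.lt_iff_exists_real_btwn.1 hb
  have hbb : b' < b := by exact_mod_cast hbb
  set r := min r₀ 1
  have hr : 0 < r := lt_min hr₀ one_pos
  refine (lowerDeltaEntropyAt_antitone μ T δ (min_le_left r₀ 1)).trans ?_
  set L' := max L 1
  have hL1 : 1 ≤ L' := le_max_right _ _
  have hL1' : (1 : ℝ) ≤ L' := by exact_mod_cast hL1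
  have hL' : LipschitzWith L' T := hL.weaken (le_max_left _ _)
  -- With a constant label this is just inner regularity; the bound `1 / 2` ensures that `K` has
  -- positive measure.
  obtain ⟨K, hK, hKμ, -⟩ := exists_isCompact_uniform_label (μ := μ) (A := Unit)
    (lab := fun _ => ()) measurable_const (show 0 < min (δ / 4) (1 / 2) by positivity)
  have hKμ' : 0 < μ.real K := by
    rw [probReal_compl_eq_one_sub hK.measurableSet] at hKμ
    linarith [min_le_right (δ / 4) (1 / 2)]
  -- The order of choices matters: `Γ` depends on `K`, `r` and `L'` only; then `a` is small against
  -- `Γ`, `q` makes long absences rare relative to `a`, and the label is fine relative to `q`.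
  obtain ⟨Γ, hΓ, N, f, hf⟩ := (hbox K hK).exists_code hr (min_le_right r₀ 1) hL1'
  set ε := min ((b - b') / 2) (δ / 4) with hε
  have hε0 : 0 < ε := lt_min (by linarith) (by linarith)
  set a := (b - b') / (4 * (Γ + 1)) with ha
  have ha0 : 0 < a := div_pos (by linarith) (by linarith)
  have haΓ : 2 * a * Γ ≤ (b - b') / 2 := by
    have : a * (4 * (Γ + 1)) = b - b' := div_mul_cancel₀ _ (by positivity)
    nlinarith
  obtain ⟨q, hqμ, hq⟩ := (((tendsto_measureReal_avoid hT hK.measurableSet hKμ').eventually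
    (gt_mem_nhds (show 0 < a * (δ / 4) by positivity))).and (eventually_gt_atTop 0)).exists
  obtain ⟨k, lab, hlab, h₀, hdist⟩ := exists_label_of_isCompact hK
    (show 0 < r / (L' : ℝ) ^ (2 * q) by positivity)
  have hrate : entropyRate μ T lab ≤ b' := by
    have h1 : entropyOfPartition μ T (FinPartition.ofLabel lab hlab) ≤ entropy μ T :=
      le_iSup₂ (f := fun (k : ℕ) (P : FinPartition X k) => entropyOfPartition μ T P) _ _
    rw [entropyOfPartition_eq_entropyRate hT _ hlab (fun x j => Iff.rfl)] at h1
    exact_mod_cast h1.trans hb'.le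
  set F := {x | ∀ i < q, T^[i] x ∉ K} with hF
  have hFm : MeasurableSet F := by
    have : F = ⋂ i ∈ Finset.range q, T^[i] ⁻¹' Kᶜ := by
      ext x; simp [hF]
    rw [this]
    exact Finset.measurableSet_biInter _ fun i _ => hTm.iterate i hK.measurableSet.compl
  refine liminf_le_of_frequently_le' (Eventually.frequently ?_)
  filter_upwards [exists_words_card_le_exp_entropyRate hT hlab hε0, eventually_gt_atTop 0]
    with n ⟨W, hWcard, hWμ⟩ hn
  obtain ⟨C, hCcard, hC⟩ := exists_cover_card_le (a := a) (q := q) (n := n) hL1 hL' h₀ hq hΓ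
    (fun x hx y hy hxy => by
      have := hdist x hx y hy hxy
      rwa [lt_div_iff₀ (by positivity), mul_comm] at this) hf W
  have hWm := measurableSet_itinerary_mem hTm hlab n (W : Set (Fin n → Fin (k + 1)))
  have hGm : MeasurableSet {x | visits T F n x ≤ n * a} :=
    measurableSet_le (measurable_visits hTm hFm n) measurable_const
  -- Each of the three intersected sets has a complement of measure at most `δ / 4`, leaving a
  -- strict margin.
  refine log_coverNumber_div_le hn ((hK.measurableSet.inter hWm).inter hGm) ?_ C hC ?_
  · have hG : μ.real {x | visits T F n x ≤ n * a}ᶜ ≤ δ / 4 := by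
      have : {x | visits T F n x ≤ n * a}ᶜ = {x | n * a < visits T F n x} := by ext x; simp
      rw [this]
      exact measureReal_visits_gt_le hT.toMeasurePreserving hFm ha0 hqμ.le hn
    have hWc : μ.real {x | itinerary T lab n x ∈ (W : Set (Fin n → Fin (k + 1)))}ᶜ ≤ δ / 4 := by
      rw [probReal_compl_eq_one_sub hWm]
      have : ε ≤ δ / 4 := min_le_right _ _
      simp only [Finset.mem_coe]
      linarith
    have h1 := probReal_compl_eq_one_sub (μ := μ) ((hK.measurableSet.inter hWm).inter hGm)
    rw [Set.compl_inter, Set.compl_inter] at h1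
    have h2 := measureReal_union_le (μ := μ)
      (Kᶜ ∪ {x | itinerary T lab n x ∈ (W : Set (Fin n → Fin (k + 1)))}ᶜ)
      {x | visits T F n x ≤ n * a}ᶜ
    have h3 := measureReal_union_le (μ := μ) Kᶜ
      {x | itinerary T lab n x ∈ (W : Set (Fin n → Fin (k + 1)))}ᶜ
    have h4 : min (δ / 4) (1 / 2) ≤ δ / 4 := min_le_left _ _
    linarith
  · refine hCcard.trans ((mul_le_mul_of_nonneg_right hWcard (Real.exp_pos _).le).trans ?_)
    rw [← Real.exp_add, ← mul_add]
    refine Real.exp_le_exp.2 (mul_le_mul_of_nonneg_left ?_ n.cast_nonneg)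
    have : ε ≤ (b - b') / 2 := min_le_left _ _
    linarith

end UpperBound

/-! ### Stability of finite box dimension and the Euclidean grid. -/

section BoxDim

variable {X : Type*} [MetricSpace X]

theorem FiniteBoxDim.of_code {K : Set X} {C : ℝ} (D : ℕ) (hC : 1 ≤ C)
    (h : ∀ ρ : ℝ, 0 < ρ → ρ ≤ 1 → ∃ (ι : Type) (s : Finset ι) (g : X → ι),
      (s.card : ℝ) ≤ C * ρ⁻¹ ^ D ∧ (∀ x ∈ K, g x ∈ s) ∧
      ∀ x ∈ K, ∀ y ∈ K, g x = g y → dist x y < ρ) : FiniteBoxDim K := by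
  classical
  refine ⟨C, D, hC, fun ρ hρ hρ1 => ?_⟩
  obtain ⟨ι, s, g, hs, hg, hd⟩ := h ρ hρ hρ1
  refine ⟨s.card, fun x => if hx : g x ∈ s then s.equivFin ⟨g x, hx⟩ else 0, hs, fun x hx => ?_,
    fun x hx y hy hxy => hd x hx y hy ?_⟩
  · simp only [hg x hx, dif_pos]
    exact Fin.is_lt _
  · simp only [hg x hx, hg y hy, dif_pos] at hxy
    simpa using s.equivFin.injective (Fin.ext hxy)

theorem FiniteBoxDim.mono {K K' : Set X} (hK : FiniteBoxDim K') (h : K ⊆ K') :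
    FiniteBoxDim K := by
  obtain ⟨C, D, hC, hK⟩ := hK
  refine ⟨C, D, hC, fun ρ hρ hρ1 => ?_⟩
  obtain ⟨N, f, hN, hf, hd⟩ := hK ρ hρ hρ1
  exact ⟨N, f, hN, fun x hx => hf x (h hx), fun x hx y hy => hd x (h hx) y (h hy)⟩

theorem FiniteBoxDim.union {K K' : Set X} (hK : FiniteBoxDim K) (hK' : FiniteBoxDim K') :
    FiniteBoxDim (K ∪ K') := by
  classical
  obtain ⟨C, D, hC, hK⟩ := hK
  obtain ⟨C', D', hC', hK'⟩ := hK'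
  refine ⟨C + C', max D D', by linarith, fun ρ hρ hρ1 => ?_⟩
  obtain ⟨N, f, hN, hf, hd⟩ := hK ρ hρ hρ1
  obtain ⟨N', f', hN', hf', hd'⟩ := hK' ρ hρ hρ1
  have hρi : 1 ≤ ρ⁻¹ := one_le_inv_iff₀.2 ⟨hρ, hρ1⟩
  refine ⟨N + N', fun x => if x ∈ K then f x else N + f' x, ?_, fun x hx => ?_,
    fun x hx y hy hxy => ?_⟩
  · push_cast
    rw [add_mul]
    refine add_le_add (hN.trans ?_) (hN'.trans ?_)
    · exact mul_le_mul_of_nonneg_left (pow_le_pow_right₀ hρi (le_max_left _ _)) (by linarith)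
    · exact mul_le_mul_of_nonneg_left (pow_le_pow_right₀ hρi (le_max_right _ _)) (by linarith)
  · by_cases h : x ∈ K
    · have := hf x h
      simp only [h, if_true]; omega
    · have := hf' x (hx.resolve_left h)
      simp only [h, if_false]; omega
  · by_cases h : x ∈ K <;> by_cases h' : y ∈ K <;> simp only [h, h', if_true, if_false] at hxy
    · exact hd x h y h' hxy
    · have := hf x h; omega
    · have := hf y h'; omega
    · exact hd' x (hx.resolve_left h) y (hy.resolve_left h') (by omega)

theorem FiniteBoxDim.of_isCompact {K : Set X} (hK : IsCompact K)
    (h : ∀ x ∈ K, ∃ U ∈ 𝓝 x, FiniteBoxDim U) : FiniteBoxDim K := by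
  refine hK.induction_on ?_ (fun s t hst ht => ht.mono hst) (fun s t hs ht => hs.union ht)
    fun x hx => ?_
  · refine ⟨1, 0, le_rfl, fun ρ _ _ => ⟨0, fun _ => 0, by simp, by simp, by simp⟩⟩
  · obtain ⟨U, hU, hUb⟩ := h x hx
    exact ⟨U, mem_nhdsWithin_of_mem_nhds hU, hUb⟩

/-- A set which is parametrized by a bounded subset of a Euclidean space through a Lipschitz map has
finite box dimension. -/
theorem FiniteBoxDim.of_dist_le {d : ℕ} {U : Set X} (φ : X → EuclideanSpace ℝ (Fin d))
    (p : EuclideanSpace ℝ (Fin d)) (hφ : ∀ x ∈ U, dist (φ x) p ≤ 1) {B : ℝ} (hB : 1 ≤ B)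
    (hdist : ∀ x ∈ U, ∀ y ∈ U, dist x y ≤ B * dist (φ x) (φ y)) : FiniteBoxDim U := by
  classical
  -- In a grid of side `h = ρ / c`, points of one cell are within `B * (d + 1) * h = ρ / 2` in `X`.
  set c : ℝ := 2 * B * (d + 1) with hc
  have hc1 : 1 ≤ c := by
    have : (0 : ℝ) ≤ d := d.cast_nonneg
    nlinarith
  -- Each coordinate takes at most `2m + 1 ≤ 2 (h⁻¹ + 1) + 1 ≤ 5 h⁻¹` integer values, as `h ≤ 1`.
  refine FiniteBoxDim.of_code (C := (5 * c) ^ d) d (one_le_pow₀ (by linarith))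
    fun ρ hρ hρ1 => ?_
  set h := ρ / c with hh
  have hh0 : 0 < h := by positivity
  have hh1 : h ≤ 1 := div_le_one_of_le₀ (by linarith) (by linarith)
  set m : ℕ := ⌈h⁻¹⌉₊ with hm
  refine ⟨Fin d → ℤ, Fintype.piFinset fun _ => Finset.Icc (-m : ℤ) m,
    fun x i => ⌊(φ x i - p i) / h⌋, ?_, fun x hx => ?_, fun x hx y hy hxy => ?_⟩
  · rw [Fintype.card_piFinset, Finset.prod_const, Finset.card_univ, Fintype.card_fin, Int.card_Icc,
      ← mul_pow, Nat.cast_pow]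
    refine pow_le_pow_left₀ (Nat.cast_nonneg _) ?_ d
    have h1 : (((m : ℤ) + 1 - -(m : ℤ)).toNat : ℝ) = 2 * m + 1 := by
      rw [show ((m : ℤ) + 1 - -(m : ℤ)).toNat = 2 * m + 1 by omega]
      push_cast; ring
    have h2 : (m : ℝ) < h⁻¹ + 1 := Nat.ceil_lt_add_one (by positivity)
    have h3 : 1 ≤ h⁻¹ := one_le_inv_iff₀.2 ⟨hh0, hh1⟩
    have h4 : c * ρ⁻¹ = h⁻¹ := by rw [hh, inv_div, div_eq_mul_inv]
    rw [h1, mul_assoc, h4]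
    linarith
  · refine Fintype.mem_piFinset.2 fun i => ?_
    have h1 : |φ x i - p i| ≤ 1 := by
      have := (EuclideanSpace.dist_eq (φ x) p).symm.trans_le (hφ x hx)
      rw [← Real.dist_eq]
      refine le_trans ?_ this
      refine Real.le_sqrt_of_sq_le ?_
      exact Finset.single_le_sum (f := fun i => dist (φ x i) (p i) ^ 2)
        (fun _ _ => sq_nonneg _) (Finset.mem_univ i)
    have h2 : |(φ x i - p i) / h| ≤ m := by
      rw [abs_div, abs_of_pos hh0]
      refine le_trans ?_ (Nat.le_ceil _)
      rw [div_eq_mul_inv]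
      exact mul_le_of_le_one_left (by positivity) h1
    obtain ⟨h3, h4⟩ := abs_le.1 h2
    rw [Finset.mem_Icc]
    refine ⟨Int.le_floor.2 (by push_cast; exact h3), ?_⟩
    have h5 := (Int.floor_le _).trans h4
    rw [← Int.cast_natCast (R := ℝ), Int.cast_le] at h5
    exact h5
  · have h1 : ∀ i, dist (φ x i) (φ y i) ≤ h := by
      intro i
      have := Int.abs_sub_lt_one_of_floor_eq_floor (congrFun hxy i)
      rw [← sub_div, abs_div, abs_of_pos hh0, div_lt_one hh0, sub_sub_sub_cancel_right] at this
      exact this.le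
    have h2 : dist (φ x) (φ y) ≤ (d + 1) * h := by
      rw [EuclideanSpace.dist_eq]
      refine Real.sqrt_le_iff.2 ⟨by positivity, ?_⟩
      refine (Finset.sum_le_sum fun i _ =>
        pow_le_pow_left₀ dist_nonneg (h1 i) 2).trans ?_
      rw [Finset.sum_const, Finset.card_univ, Fintype.card_fin, nsmul_eq_mul, mul_pow]
      refine mul_le_mul_of_nonneg_right ?_ (sq_nonneg _)
      have : (0 : ℝ) ≤ d := d.cast_nonneg
      nlinarith
    calc dist x y ≤ B * dist (φ x) (φ y) := hdist x hx y hy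
      _ ≤ B * ((d + 1) * h) := by gcongr
      _ = ρ / 2 := by rw [hh, hc]; field_simp
      _ < ρ := half_lt_self hρ

end BoxDim

/-! ### Charts and the Riemannian distance. -/

section Riemannian

open Set Metric Bundle Manifold
open scoped NNReal

variable {E : Type*} [NormedAddCommGroup E] [NormedSpace ℝ E]
  {H : Type*} [TopologicalSpace H] {I : ModelWithCorners ℝ E H}
  {M : Type*} [TopologicalSpace M] [ChartedSpace H M]
  [RiemannianBundle (fun x : M => TangentSpace I x)]
  [IsManifold I 1 M] [IsContinuousRiemannianBundle E (fun x : M => TangentSpace I x)]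

attribute [local instance] normedAddCommGroupTangentSpaceVectorSpace
attribute [local instance] normedSpaceTangentSpaceVectorSpace

/-- The inverse of the extended chart is locally Lipschitz. -/
theorem exists_riemannianEDist_le_edist_extChartAt (x₀ : M) :
    ∃ C : ℝ≥0, ∃ U ∈ 𝓝 x₀, ∀ x ∈ U, ∀ y ∈ U,
      riemannianEDist I x y ≤ C * edist (extChartAt I x₀ x) (extChartAt I x₀ y) := by
  rcases eventually_enorm_mfderivWithin_symm_extChartAt_lt I x₀ with ⟨C, C_pos, hC⟩
  obtain ⟨S, hS, hSC⟩ := hC.exists_mem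
  obtain ⟨r, r_pos, hr⟩ : ∃ r > 0,
      ball (extChartAt I x₀ x₀) r ∩ range I ⊆ (extChartAt I x₀).target ∩ S :=
    mem_nhdsWithin_iff.1 (inter_mem (extChartAt_target_mem_nhdsWithin x₀) hS)
  have hU : (extChartAt I x₀) ⁻¹' (ball (extChartAt I x₀ x₀) r ∩ range I) ∈ 𝓝 x₀ := by
    apply extChartAt_preimage_mem_nhds_of_mem_nhdsWithin (by simp)
    rw [inter_comm]
    exact inter_mem_nhdsWithin _ (ball_mem_nhds _ r_pos)
  refine ⟨C, _, inter_mem hU (chart_source_mem_nhds H x₀), ?_⟩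
  rintro x ⟨hx, hx'⟩ y ⟨hy, hy'⟩
  -- The segment between the chart images stays in the convex set `ball ∩ range I`, where the
  -- derivative of the inverse chart is bounded by `C`; its image is a path from `x` to `y` of
  -- length at most `C` times that of the segment.
  let η := ContinuousAffineMap.lineMap (R := ℝ) (extChartAt I x₀ x) (extChartAt I x₀ y)
  set γ := (extChartAt I x₀).symm ∘ η
  have hη : Icc 0 1 ⊆ ⇑η ⁻¹' ((extChartAt I x₀).target ∩ S) := by
    simp only [← image_subset_iff, ContinuousAffineMap.coe_lineMap_eq,
     ← segment_eq_image_lineMap, η]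
    apply Subset.trans _ hr
    exact ((convex_ball _ _).inter I.convex_range).segment_subset hx hy
  simp only [preimage_inter, subset_inter_iff] at hη
  have η_smooth : CMDiff[Icc 0 1] 1 η := by
    apply ContMDiff.contMDiffOn
    rw [contMDiff_iff_contDiff]
    exact ContinuousAffineMap.contDiff _
  have : riemannianEDist I x y ≤ pathELength I γ 0 1 := by
    apply riemannianEDist_le_pathELength _ _ _ zero_le_one
    · exact (contMDiffOn_extChartAt_symm x₀).comp η_smooth hη.1
    · simp [γ, η, ContinuousAffineMap.coe_lineMap_eq, hx']
    · simp [γ, η, ContinuousAffineMap.coe_lineMap_eq, hy']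
  apply this.trans
  rw [← lintegral_fderiv_lineMap_eq_edist, pathELength_eq_lintegral_mfderivWithin_Icc,
    ← lintegral_const_mul' _ _ ENNReal.coe_ne_top]
  apply setLIntegral_mono' measurableSet_Icc (fun t ht ↦ ?_)
  have : mfderiv[Icc 0 1] γ t =
      (mfderiv[range I] (extChartAt I x₀).symm (η t)) ∘L (mfderiv[Icc 0 1] η t) := by
    apply mfderivWithin_comp
    · exact mdifferentiableWithinAt_extChartAt_symm (hη.1 ht)
    · exact η_smooth.mdifferentiableOn one_ne_zero t ht
    · exact hη.1.trans (preimage_mono (extChartAt_target_subset_range x₀))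
    · rw [uniqueMDiffWithinAt_iff_uniqueDiffWithinAt]
      exact uniqueDiffOn_Icc zero_lt_one t ht
  have : mfderiv[Icc 0 1] γ t 1 =
      (mfderiv[range I] (extChartAt I x₀).symm (η t)) (mfderiv[Icc 0 1] η t 1) := congr($this 1)
  rw [this]
  apply (ContinuousLinearMap.le_opENorm _ _).trans
  gcongr
  · exact (hSC _ (hη.2 ht)).le
  · simp only [mfderivWithin_eq_fderivWithin]
    exact le_of_eq rfl

end Riemannian

theorem isContinuousRiemannianBundle_of_isContMDiff {EB HB B F : Type*} [NormedAddCommGroup EB]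
    [NormedSpace ℝ EB] [TopologicalSpace HB] (IB : ModelWithCorners ℝ EB HB) {n : ℕ∞ω}
    [TopologicalSpace B] [ChartedSpace HB B] [NormedAddCommGroup F] [NormedSpace ℝ F]
    {E : B → Type*} [TopologicalSpace (Bundle.TotalSpace F E)] [∀ x, NormedAddCommGroup (E x)]
    [∀ x, InnerProductSpace ℝ (E x)] [FiberBundle F E] [VectorBundle ℝ F E]
    [h : IsContMDiffRiemannianBundle IB n F E] : IsContinuousRiemannianBundle F E := by
  obtain ⟨g, hg, hg'⟩ := h.exists_contMDiff
  exact ⟨g, hg.continuous, hg'⟩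

/-- Compact subsets of a Riemannian manifold have finite box dimension. -/
theorem finiteBoxDim_of_isCompact_riemannian (d : ℕ) {M : Type*} [MetricSpace M]
    [ChartedSpace (EuclideanSpace ℝ (Fin d)) M] [IsManifold (𝓡 d) ∞ M]
    [Bundle.RiemannianBundle (fun x : M => TangentSpace (𝓡 d) x)]
    [IsContMDiffRiemannianBundle (𝓡 d) ∞ (EuclideanSpace ℝ (Fin d))
      (fun x : M => TangentSpace (𝓡 d) x)]
    [IsRiemannianManifold (𝓡 d) M] {K : Set M} (hK : IsCompact K) : FiniteBoxDim K := by
  have : IsManifold (𝓡 d) 1 M := IsManifold.of_le (n := ∞) (by norm_cast)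
  have : IsContinuousRiemannianBundle (EuclideanSpace ℝ (Fin d))
      (fun x : M => TangentSpace (𝓡 d) x) :=
    isContinuousRiemannianBundle_of_isContMDiff (𝓡 d) (n := ∞)
  refine FiniteBoxDim.of_isCompact hK fun x₀ _ => ?_
  obtain ⟨C, U, hU, hC⟩ := exists_riemannianEDist_le_edist_extChartAt (I := 𝓡 d) x₀
  set φ : M → EuclideanSpace ℝ (Fin d) := fun x => extChartAt (𝓡 d) x₀ x
  have hφ : φ ⁻¹' Metric.closedBall (φ x₀) 1 ∈ 𝓝 x₀ :=
    (continuousAt_extChartAt x₀).preimage_mem_nhds (Metric.closedBall_mem_nhds _ one_pos)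
  refine ⟨U ∩ φ ⁻¹' Metric.closedBall (φ x₀) 1, inter_mem hU hφ,
    FiniteBoxDim.of_dist_le φ (φ x₀) (fun x hx => hx.2) (le_max_right (C : ℝ) 1)
      fun x hx y hy => ?_⟩
  have h := hC x hx.1 y hy.1
  rw [← IsRiemannianManifold.out (I := 𝓡 d), edist_nndist, edist_nndist, ← ENNReal.coe_mul,
    ENNReal.coe_le_coe] at h
  have h' : dist x y ≤ C * dist (φ x) (φ y) := by exact_mod_cast h
  exact h'.trans (mul_le_mul_of_nonneg_right (le_max_left _ _) dist_nonneg)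

end KatokEntropy

theorem theorem3p4 (d : ℕ) {M : Type*}
    -- `M` is a complete smooth Riemannian manifold of dimension `d` without boundary;
    -- `dist` is the Riemannian distance (finite, so that `M` is connected).
    [MetricSpace M] [SecondCountableTopology M]
    [ChartedSpace (EuclideanSpace ℝ (Fin d)) M] [IsManifold (𝓡 d) ∞ M]
    [Bundle.RiemannianBundle (fun x : M => TangentSpace (𝓡 d) x)]
    [IsContMDiffRiemannianBundle (𝓡 d) ∞ (EuclideanSpace ℝ (Fin d))
      (fun x : M => TangentSpace (𝓡 d) x)]
    [IsRiemannianManifold (𝓡 d) M] [CompleteSpace M]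
    [MeasurableSpace M] [BorelSpace M]
    (T : M → M) (hT : ∃ L : NNReal, LipschitzWith L T)
    (μ : Measure M) [IsProbabilityMeasure μ] (hμ : Ergodic T μ)
    (δ : ℝ) (hδ0 : 0 < δ) (hδ1 : δ < 1) :
    KatokEntropy.entropy μ T = KatokEntropy.lowerDeltaEntropy μ T δ := by
  obtain ⟨L, hL⟩ := hT
  refine le_antisymm (iSup₂_le fun k P => ?_) (KatokEntropy.lowerDeltaEntropy_le_entropy hL hμ
    (fun K hK => KatokEntropy.finiteBoxDim_of_isCompact_riemannian d hK) hδ0)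
  obtain ⟨lab, hlab, hP⟩ := P.exists_label
  rw [KatokEntropy.entropyOfPartition_eq_entropyRate hμ P hlab hP]
  exact KatokEntropy.entropyRate_le_lowerDeltaEntropy hμ hlab hδ1
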